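/- **Theorem 2 (Lower bound for admissible data).** Consider discounted MDPs $M=(\mathcal S,\mathcal A,P,R,\gamma,d_0)$ with finite $\mathcal S,\mathcal A$, rewards $R:\mathcal S\times\mathcal A\to[0,1]$, discount factor $\gamma$ and initial distribution $d_0$. For a policy $\pi$ let $J_M(\pi)=\mathbb E^{\pi}_M\big[\sum_{h\ge 0}\gamma^h R(s_h,a_h)\big]$ and let $Q^\pi_M(s,a)$ be the same expectation started from $(s_0,a_0)=(s,a)$. A distribution $\nu\in\Delta(\mathcal S\times\mathcal A)$ is *admissible* for $M$ if $\nu(s,a)=\mathbb P^\pi_M(s_h=s,a_h=a)$ for some (possibly randomized and non-stationary) policy $\pi$ and some $h\ge0$. For $\mu\in\Delta(\mathcal S\times\mathcal A)$ the concentrability coefficient is $C_{\mathrm{conc}}=\sup_{\nu\text{ admissible for }M}\ \sup_{(s,a)}\nu(s,a)/\mu(s,a)$ (with $0/0=0$ and $x/0=\infty$ for $x>0$). There are absolute constants $c,c'>0$ such that for every integer $S\ge 9$, every $\gamma\in(1/2,1)$ and every real $C\ge 64$ there exist a family $\mathcal M$ of MDPs with common state space, $|\mathcal S|=S$, common action space,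 $|\mathcal A|=2$, discount factor $\gamma$ and a common initial distribution, a class $\mathcal F$ of functions $\mathcal S\times\mathcal A\to\mathbb R$ with $|\mathcal F|=2$, and a single distribution $\mu$ on $\mathcal S\times\mathcal A$ which, for every $M\in\mathcal M$, is a mixture of distributions admissible for $M$, such that: 1. for every $M\in\mathcal M$, $Q^\pi_M\in\mathcal F$ for all $\pi:\mathcal S\to\Delta(\mathcal A)$ (all-policy realizability) and $C_{\mathrm{conc}}\le C$ (concentrability); 2. for every integer $n\ge0$ with $n<c\cdot\min\{S^{1/3}/(\log S)^2,\ 2^{C/32},\ 2^{1/(1-\gamma)}\}$ and every (possibly randomized) algorithm that maps a dataset $D_n$ of $n$ i.i.d. tuples $(s,a,r,s')$, where $(s,a)\sim\mu$, $r=R(s,a)$, $s'\sim P(s,a)$, to a policy $\hat\pi:\mathcal S\to\Delta(\mathcal A)$, there is an instance $M\in\mathcal M$ with an optimal (deterministic) policy $\pi^\star$ such that $J_M(\pi^\star)-\mathbb E[J_M(\hat\pi)]\ge c'$, where the expectation is over $D_n$ generated from $M$ and the randomness of the algorithm. -/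

import Mathlib

open MeasureTheory ProbabilityTheory Finset
open scoped ENNReal

/-- The sigma-algebra on the set of probability mass functions on `α` that is generated by the
evaluation maps `p ↦ p a`. -/
instance PMF.evalMeasurableSpace (α : Type*) : MeasurableSpace (PMF α) :=
  MeasurableSpace.comap (fun (p : PMF α) (a : α) => p a) inferInstance

/-- A discounted Markov decision process with state space `S` and action space `A`:
transition probabilities, deterministic rewards in `[0,1]`, discount factor in `[0,1)`
and initial state distribution. -/
structure MDP (S A : Type*) where
  /-- transition probabilities -/
  P : S → A → PMF S
  /-- reward function -/
  R : S → A → ℝ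
  R_mem : ∀ s a, R s a ∈ Set.Icc (0 : ℝ) 1
  /-- discount factor -/
  γ : ℝ
  γ_mem : γ ∈ Set.Ico (0 : ℝ) 1
  /-- initial state distribution -/
  d₀ : PMF S

/-- A stationary randomized policy. -/
abbrev Policy (S A : Type*) := S → PMF A

namespace MDP

noncomputable section

variable {S A : Type*}

/-- The stationary policy that plays the action `f s` in state `s`. -/
def detPolicy (f : S → A) : Policy S A := fun s => PMF.pure (f s)

/-- The law of `(s, a)` when `s ∼ p` and then `a ∼ π s`. -/
def joinAction (p : PMF S) (π : Policy S A) : PMF (S × A) :=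
  p.bind fun s => (π s).map fun a => (s, a)

variable [Finite S] [MeasurableSpace S] [MeasurableSingletonClass S]
  [Finite A] [MeasurableSpace A] [MeasurableSingletonClass A]

/-- The conditional law of `(s_{h+1}, a_{h+1})` given `(s_0, a_0), …, (s_h, a_h)` under the
(possibly non-stationary) policy `π`. -/
def stepKernel (M : MDP S A) (π : ℕ → Policy S A) (h : ℕ) :
    Kernel (∀ _ : Iic h, S × A) (S × A) :=
  Kernel.ofFunOfCountable fun x =>
    (joinAction (M.P (x ⟨h, mem_Iic.2 le_rfl⟩).1 (x ⟨h, mem_Iic.2 le_rfl⟩).2)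
      (π (h + 1))).toMeasure

instance (M : MDP S A) (π : ℕ → Policy S A) (h : ℕ) : IsMarkovKernel (M.stepKernel π h) :=
  ⟨fun _ => PMF.toMeasure.isProbabilityMeasure _⟩

/-- The law of the trajectory `(s_0, a_0), (s_1, a_1), …` when `(s_0, a_0) ∼ ρ`, and from then on
`s_{h+1} ∼ P(s_h, a_h)`, `a_{h+1} ∼ π_{h+1}(s_{h+1})`. -/
def trajFrom (M : MDP S A) (π : ℕ → Policy S A) (ρ : PMF (S × A)) : Measure (ℕ → S × A) :=
  Kernel.trajMeasure (X := fun _ => S × A) ρ.toMeasure (M.stepKernel π)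

/-- The law of the trajectory in `M` under `π`, with `s_0 ∼ d₀`. -/
def traj (M : MDP S A) (π : ℕ → Policy S A) : Measure (ℕ → S × A) :=
  M.trajFrom π (joinAction M.d₀ (π 0))

/-- The discounted return `∑ γ ^ h r_h` along a trajectory. -/
def discountedReturn (M : MDP S A) (ω : ℕ → S × A) : ℝ :=
  ∑' h, M.γ ^ h * M.R (ω h).1 (ω h).2

/-- The expected return `J(π)` of a stationary policy. -/
def J (M : MDP S A) (π : Policy S A) : ℝ :=
  ∫ ω, M.discountedReturn ω ∂(M.traj fun _ => π)

/-- The value function `V^π`: expected return from `s_0 = s`. -/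
def V (M : MDP S A) (π : Policy S A) (s : S) : ℝ :=
  ∫ ω, M.discountedReturn ω ∂(M.trajFrom (fun _ => π) (joinAction (PMF.pure s) π))

/-- The function `Q^π`: expected return from `s_0 = s`, `a_0 = a`. -/
def Q (M : MDP S A) (π : Policy S A) (s : S) (a : A) : ℝ :=
  ∫ ω, M.discountedReturn ω ∂(M.trajFrom (fun _ => π) (PMF.pure (s, a)))

/-- `f` is an optimal deterministic policy: it maximizes the value in all states at once. -/
def IsOptimal (M : MDP S A) (f : S → A) : Prop :=
  ∀ (π : Policy S A) (s : S), M.V π s ≤ M.V (detPolicy f) s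

/-- `ν` is admissible: the law of `(s_h, a_h)` for some (randomized, possibly non-stationary)
policy and some time `h`. -/
def Admissible (M : MDP S A) (ν : PMF (S × A)) : Prop :=
  ∃ (π : ℕ → Policy S A) (h : ℕ), ∀ x, ν x = M.traj π {ω | ω h = x}

/-- `μ` is a mixture of distributions that are admissible for `M`. -/
def IsAdmissibleMixture (M : MDP S A) (μ : PMF (S × A)) : Prop :=
  ∃ w : PMF (PMF (S × A)), (∀ ν ∈ w.support, M.Admissible ν) ∧ μ = w.bind id

/-- The concentrability coefficient: supremum of `ν(s,a) / μ(s,a)` over all admissible `ν` and all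
`(s,a)`. In `ℝ≥0∞` one has `x / 0 = ∞` for `x ≠ 0`, and `0 / 0 = 0`. -/
def concCoeff (M : MDP S A) (μ : PMF (S × A)) : ℝ≥0∞ :=
  ⨆ (ν : PMF (S × A)) (_ : M.Admissible ν) (x : S × A), ν x / μ x

/-- The law of one sample `(s, a, r, s')`: `(s,a) ∼ μ`, `r = R(s,a)`, `s' ∼ P(s,a)`. -/
def sampleLaw {S A : Type*} (M : MDP S A) (μ : PMF (S × A)) : PMF (S × A × ℝ × S) :=
  μ.bind fun x => (M.P x.1 x.2).map fun s' => (x.1, x.2, M.R x.1 x.2, s')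

/-- The law of a dataset of `n` i.i.d. samples. -/
def dataLaw {S A : Type*} [MeasurableSpace S] [MeasurableSpace A] (M : MDP S A)
    (μ : PMF (S × A)) (n : ℕ) : Measure (Fin n → S × A × ℝ × S) :=
  Measure.pi fun _ => (M.sampleLaw μ).toMeasure

end

end MDP

/-!
The hard instances have two initial states that matter. In `decide`, one action leads to the first
of `K` layers, the other one has a known value `safe`. Each layer consists of `M` groups of `K`
states, one of which is planted, in a position hidden from the learner. Planted states move to the
terminal states `one` (reward one, once) or `zero`. The others move, except for terminal
transitions, to a *planted* state of the next layer, and from the last layer to `hidden`, the only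
state with an unknown reward `z`, which is `0` or `1`. The terminal transitions give planted and
non-planted states of a layer the same value (`HardParams.qFun_eq`), so that no policy has any
influence after `decide`: all policies have the same `Q`-function, one for each value of `z`. As
the value of a layer satisfies `v l = γ * (pay + surv * v (l + 1))` with `surv = (1 - 1 / K) ^ 2`,
the influence of `z` on the first layer is `(γ * surv) ^ K`. This is of constant order, since
`K ≤ 1 / (1 - γ)`, and `safe` lies halfway between the two possible values.

The learner does not see `z`, because real trajectories hit only planted states in the next layer
and stop there: non-planted states of the later layers are reached only from the second initial
state `explore`, with exponentially decaying probabilities. The data distribution is essentially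
the occupancy of the uniform policy, discounted at rate `1 / (2 * K)`. This rate is chosen such
that the planted states entered from the previous layer, at the later time, and the non-planted
states entered from `explore` add up to the uniform distribution on each layer
(`HardParams.stateMass_flow`). Thus the data distribution does not depend on the instance, it is a
mixture of admissible distributions (`HardParams.isAdmissibleMixture_data`), it loses only a factor
of order `K` against any admissible distribution (`HardParams.concCoeff_data_le`), and the mass of
`hidden` is of order `2 ^ (-K)`.

The mean of the transition probabilities over uniformly random planted positions does not depend on
`z` (`HardParams.expect_trans`). Hence samples that touch pairwise different groups, and avoid
`hidden`, have the same averaged law for `z = 0` and `z = 1`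
(`HardParams.expect_tripleLaw_prod`). All other datasets have probability at most
`n * 2 ^ (-K) / 32 + 4 * n ^ 2 / M` (`HardParams.le_sum_good`), so an algorithm cannot tell which
action in `decide` is better (`HardParams.exists_regret`). With
`K = min (C / 32) (1 / (1 - γ)) (log₂ S - 1)`, rounded down, and `M` of order `S / K ^ 2`, this is
the claimed bound.
-/

/-! ### State-action laws and the Bellman equation -/

namespace MDP

section Occupancy

variable {S A : Type*}

/-- The law of `(s_h, a_h)` when `(s_0, a_0) ∼ ρ` and the policy `π` is followed from then on,
as an iterated bind of probability mass functions. -/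
noncomputable def stateActionLaw (M : MDP S A) (π : ℕ → Policy S A) (ρ : PMF (S × A)) :
    ℕ → PMF (S × A)
  | 0 => ρ
  | h + 1 => (stateActionLaw M π ρ h).bind fun x => joinAction (M.P x.1 x.2) (π (h + 1))

theorem joinAction_apply (p : PMF S) (π : Policy S A) (s : S) (a : A) :
    joinAction p π (s, a) = p s * π s a := by
  classical
  rw [joinAction, PMF.bind_apply, tsum_eq_single s]
  · rw [PMF.map_apply, tsum_eq_single a]
    · simp
    · intro a' ha'
      simp [Ne.symm ha']
  · intro s' hs'
    rw [PMF.map_apply]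
    simp [Ne.symm hs']

variable [Finite S] [MeasurableSpace S] [MeasurableSingletonClass S]
  [Finite A] [MeasurableSpace A] [MeasurableSingletonClass A]

instance (M : MDP S A) (π : ℕ → Policy S A) (ρ : PMF (S × A)) :
    IsProbabilityMeasure (M.trajFrom π ρ) := by
  unfold trajFrom
  infer_instance

theorem trajFrom_map_zero (M : MDP S A) (π : ℕ → Policy S A) (ρ : PMF (S × A)) :
    (M.trajFrom π ρ).map (fun ω => ω 0) = ρ.toMeasure := by
  have h1 : (fun ω : ℕ → S × A => ω 0) =
      (fun x : (∀ _ : Iic 0, S × A) => x ⟨0, mem_Iic.2 le_rfl⟩) ∘ Preorder.frestrictLe 0 := by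
    ext ω <;> rfl
  rw [h1, ← Measure.map_map (by fun_prop) (by fun_prop), trajFrom, Kernel.trajMeasure,
    Measure.map_comp _ _ (by fun_prop), Kernel.traj_map_frestrictLe, Kernel.partialTraj_self,
    Measure.id_comp, Measure.map_map (by fun_prop) (by fun_prop)]
  convert Measure.map_id
  rfl

theorem trajFrom_map_succ (M : MDP S A) (π : ℕ → Policy S A) (ρ : PMF (S × A)) (h : ℕ)
    (y : S × A) :
    (M.trajFrom π ρ).map (fun ω => ω (h + 1)) {y} =
      ∫⁻ x, joinAction (M.P x.1 x.2) (π (h + 1)) y ∂((M.trajFrom π ρ).map (fun ω => ω h)) := by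
  have key := Kernel.map_frestrictLe_trajMeasure_compProd_eq_map_trajMeasure
    (X := fun _ => S × A) (μ₀ := ρ.toMeasure) (κ := M.stepKernel π) (a := h)
  have h1 : (M.trajFrom π ρ).map (fun ω => ω (h + 1)) =
      ((M.trajFrom π ρ).map (fun x => (Preorder.frestrictLe h x, x (h + 1)))).map Prod.snd := by
    rw [Measure.map_map (by fun_prop) (by fun_prop)]
    rfl
  rw [h1, trajFrom, ← key, Measure.map_apply measurable_snd (measurableSet_singleton y),
    Measure.compProd_apply (measurable_snd (measurableSet_singleton y)),
    lintegral_map (Kernel.measurable_kernel_prodMk_left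
      (measurable_snd (measurableSet_singleton y))) (by fun_prop),
    lintegral_map (measurable_of_finite _) (by fun_prop)]
  refine lintegral_congr fun ω => ?_
  have : Prod.mk (Preorder.frestrictLe (π := fun _ => S × A) h ω) ⁻¹' (Prod.snd ⁻¹' {y}) = {y} := by
    ext z; simp
  rw [this]
  exact PMF.toMeasure_apply_singleton _ _ (measurableSet_singleton y)

/-- The time-`h` marginal of the trajectory measure. -/
theorem trajFrom_map (M : MDP S A) (π : ℕ → Policy S A) (ρ : PMF (S × A)) (h : ℕ) :
    (M.trajFrom π ρ).map (fun ω => ω h) = (M.stateActionLaw π ρ h).toMeasure := by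
  induction h with
  | zero => exact M.trajFrom_map_zero π ρ
  | succ h ih =>
    refine Measure.ext_of_singleton fun y => ?_
    rw [trajFrom_map_succ, ih, PMF.toMeasure_apply_singleton _ _ (measurableSet_singleton y),
      stateActionLaw, PMF.bind_apply, lintegral_countable']
    refine tsum_congr fun x => ?_
    rw [PMF.toMeasure_apply_singleton _ _ (measurableSet_singleton x), mul_comm]

theorem traj_apply_eq (M : MDP S A) (π : ℕ → Policy S A) (h : ℕ) (x : S × A) :
    M.traj π {ω | ω h = x} = M.stateActionLaw π (joinAction M.d₀ (π 0)) h x := by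
  rw [← PMF.toMeasure_apply_singleton _ x (measurableSet_singleton x), ← trajFrom_map,
    Measure.map_apply (by fun_prop) (measurableSet_singleton x)]
  rfl

theorem admissible_iff (M : MDP S A) (ν : PMF (S × A)) :
    M.Admissible ν ↔
      ∃ (π : ℕ → Policy S A) (h : ℕ), ν = M.stateActionLaw π (joinAction M.d₀ (π 0)) h := by
  simp only [Admissible, traj_apply_eq, DFunLike.ext_iff]

end Occupancy

section Bellman

variable {S A : Type*} [Fintype S] [Fintype A]

theorem sum_toReal_eq_one {α : Type*} [Fintype α] (p : PMF α) : ∑ x, (p x).toReal = 1 := by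
  rw [← ENNReal.toReal_sum fun x _ => p.apply_ne_top x, ← tsum_fintype (L := .unconditional _), p.tsum_coe,
    ENNReal.toReal_one]

theorem toReal_bind_apply {α β : Type*} [Fintype α] (p : PMF α) (f : α → PMF β) (y : β) :
    (p.bind f y).toReal = ∑ x, (p x).toReal * (f x y).toReal := by
  rw [PMF.bind_apply, tsum_fintype, ENNReal.toReal_sum fun x _ =>
    ENNReal.mul_ne_top (p.apply_ne_top x) ((f x).apply_ne_top y)]
  simp

variable [MeasurableSpace S] [MeasurableSingletonClass S]
  [MeasurableSpace A] [MeasurableSingletonClass A]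

theorem integral_trajFrom_eval (M : MDP S A) (π : ℕ → Policy S A) (ρ : PMF (S × A)) (h : ℕ)
    (f : S × A → ℝ) :
    ∫ ω, f (ω h) ∂(M.trajFrom π ρ) = ∑ x, (M.stateActionLaw π ρ h x).toReal * f x := by
  rw [← integral_map (φ := fun ω : ℕ → S × A => ω h) (measurable_pi_apply h).aemeasurable
    (measurable_of_finite f).aestronglyMeasurable, trajFrom_map, PMF.integral_eq_sum]
  rfl

/-- A solution `q` of the Bellman equation of a stationary policy computes its expected return:
the discounted sum of rewards telescopes. -/
theorem integral_discountedReturn_of_bellman (M : MDP S A) (π : Policy S A) (ρ : PMF (S × A))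
    (q : S × A → ℝ)
    (hq : ∀ x, q x = M.R x.1 x.2 +
      M.γ * ∑ y, (joinAction (M.P x.1 x.2) π y).toReal * q y) :
    ∫ ω, M.discountedReturn ω ∂(M.trajFrom (fun _ => π) ρ) = ∑ x, (ρ x).toReal * q x := by
  set μ := M.trajFrom (fun _ => π) ρ
  set L := M.stateActionLaw (fun _ => π) ρ
  have hγ0 := M.γ_mem.1
  have hγ1 := M.γ_mem.2
  have hmeas : ∀ h, Measurable fun ω : ℕ → S × A => M.R (ω h).1 (ω h).2 := fun h =>
    (measurable_of_finite fun x : S × A => M.R x.1 x.2).comp (measurable_pi_apply h)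
  have hint : ∀ h, Integrable (fun ω : ℕ → S × A => M.γ ^ h * M.R (ω h).1 (ω h).2) μ := fun h =>
    (Integrable.of_bound (hmeas h).aestronglyMeasurable 1 (.of_forall fun ω => by
      rw [Real.norm_of_nonneg (M.R_mem _ _).1]; exact (M.R_mem _ _).2)).const_mul _
  have hnorm : ∀ h, ∫ ω, ‖M.γ ^ h * M.R (ω h).1 (ω h).2‖ ∂μ ≤ M.γ ^ h := fun h => by
    calc _ ≤ ∫ _, M.γ ^ h ∂μ := by
          refine integral_mono (hint h).norm (integrable_const _) fun ω => ?_
          have := M.R_mem (ω h).1 (ω h).2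
          rw [Real.norm_of_nonneg (mul_nonneg (pow_nonneg hγ0 _) this.1)]
          exact mul_le_of_le_one_right (pow_nonneg hγ0 _) this.2
      _ = _ := by simp
  have hsum := hasSum_integral_of_summable_integral_norm hint
    (Summable.of_nonneg_of_le (fun h => integral_nonneg fun ω => norm_nonneg _) hnorm
      (summable_geometric_of_lt_one hγ0 hγ1))
  set E : ℕ → ℝ := fun h => ∑ x, (L h x).toReal * q x with hE
  have hstep : ∀ h, ∫ ω, M.γ ^ h * M.R (ω h).1 (ω h).2 ∂μ =
      M.γ ^ h * E h - M.γ ^ (h + 1) * E (h + 1) := fun h => by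
    have e1 : ∫ ω, M.R (ω h).1 (ω h).2 ∂μ = ∑ x, (L h x).toReal * M.R x.1 x.2 :=
      M.integral_trajFrom_eval _ ρ h fun x => M.R x.1 x.2
    have e2 : E (h + 1) = ∑ x, (L h x).toReal *
        ∑ y, (joinAction (M.P x.1 x.2) π y).toReal * q y := by
      simp only [hE, L, stateActionLaw, toReal_bind_apply, Finset.sum_mul, Finset.mul_sum]
      rw [Finset.sum_comm]
      simp only [mul_assoc]
    have e3 : E h = ∑ x, (L h x).toReal * M.R x.1 x.2 + M.γ * E (h + 1) := by
      rw [e2, Finset.mul_sum, ← Finset.sum_add_distrib]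
      refine Finset.sum_congr rfl fun x _ => ?_
      rw [hq x]; ring
    rw [integral_const_mul, e1, e3]; ring
  have htel : ∀ n, ∑ h ∈ Finset.range n, ∫ ω, M.γ ^ h * M.R (ω h).1 (ω h).2 ∂μ =
      E 0 - M.γ ^ n * E n := fun n => by
    induction n with
    | zero => simp
    | succ n ih => rw [Finset.sum_range_succ, ih, hstep]; ring
  have hbound : ∀ n, ‖E n‖ ≤ ∑ x, |q x| := fun n => by
    refine (norm_sum_le _ _).trans (Finset.sum_le_sum fun x _ => ?_)
    rw [norm_mul, Real.norm_of_nonneg ENNReal.toReal_nonneg, Real.norm_eq_abs]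
    exact mul_le_of_le_one_left (abs_nonneg _)
      (ENNReal.toReal_le_of_le_ofReal zero_le_one (by simpa using (L n).coe_le_one x))
  have hlim : Filter.Tendsto (fun n => E 0 - M.γ ^ n * E n) Filter.atTop (nhds (E 0)) := by
    have : Filter.Tendsto (fun n => M.γ ^ n * E n) Filter.atTop (nhds 0) := by
      refine squeeze_zero_norm (a := fun n => M.γ ^ n * ∑ x, |q x|) (fun n => ?_) ?_
      · rw [norm_mul, Real.norm_of_nonneg (pow_nonneg hγ0 _)]
        exact mul_le_mul_of_nonneg_left (hbound n) (pow_nonneg hγ0 _)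
      · simpa using (tendsto_pow_atTop_nhds_zero_of_lt_one hγ0 hγ1).mul_const (∑ x, |q x|)
    simpa using this.const_sub (E 0)
  have := tendsto_nhds_unique hsum.tendsto_sum_nat (by simpa only [htel] using hlim)
  exact this

end Bellman

end MDP

/-! ### Independence under random choices, and collisions -/

section Averaging

variable {ι κ : Type*} [Fintype ι] [DecidableEq ι] [Fintype κ]

/-- Under the uniform distribution on `ι → κ`, functions of disjoint sets of coordinates are
uncorrelated. -/
theorem expect_mul_of_dependsOn [Nonempty κ] {f g : (ι → κ) → ℝ} {T U : Set ι}
    (hf : DependsOn f T) (hg : DependsOn g U) (hTU : Disjoint T U) :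
    Finset.expect univ (fun b => f b * g b) = Finset.expect univ f * Finset.expect univ g := by
  classical
  -- Swapping the coordinates in `T` between two independent copies turns `f b * g b` into
  -- `f b * g b'`.
  let swap : (ι → κ) × (ι → κ) → (ι → κ) × (ι → κ) := fun p =>
    (fun i => if i ∈ T then p.1 i else p.2 i, fun i => if i ∈ T then p.2 i else p.1 i)
  have hswap : Function.Involutive swap := fun p => by
    ext i <;> by_cases h : i ∈ T <;> simp [swap, h]
  have h1 : ∑ p : (ι → κ) × (ι → κ), f p.1 * g p.1 = ∑ p : (ι → κ) × (ι → κ), f p.1 * g p.2 := by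
    rw [← Equiv.sum_comp (hswap.toPerm swap)]
    refine Finset.sum_congr rfl fun p _ => ?_
    congr 1
    · exact hf fun i hi => by simp [swap, hi]
    · exact hg fun i hi => by simp [swap, hTU.notMem_of_mem_right hi]
  have hcard : (Fintype.card (ι → κ) : ℝ) ≠ 0 := by
    exact_mod_cast Fintype.card_ne_zero
  rw [Fintype.sum_prod_type, Fintype.sum_prod_type, ← Finset.sum_mul_sum] at h1
  simp only [Finset.sum_const, Finset.card_univ, nsmul_eq_mul, ← Finset.mul_sum] at h1
  rw [Fintype.expect_eq_sum_div_card, Fintype.expect_eq_sum_div_card,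
    Fintype.expect_eq_sum_div_card, div_mul_div_comm, ← h1]
  field_simp

theorem expect_prod_of_dependsOn [Nonempty κ] {J : Type*} (s : Finset J)
    {f : J → (ι → κ) → ℝ} {T : J → Set ι} (hf : ∀ j ∈ s, DependsOn (f j) (T j))
    (hT : (s : Set J).PairwiseDisjoint T) :
    Finset.expect univ (fun b => ∏ j ∈ s, f j b) = ∏ j ∈ s, Finset.expect univ (f j) := by
  classical
  induction s using Finset.induction_on with
  | empty => simp
  | insert j s hj ih =>
    simp only [Finset.prod_insert hj]
    rw [← ih (fun k hk => hf k (Finset.mem_insert_of_mem hk))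
      (hT.subset (by simp))]
    refine expect_mul_of_dependsOn (U := ⋃ k ∈ s, T k) (hf j (Finset.mem_insert_self _ _)) ?_ ?_
    · intro b b' hb
      refine Finset.prod_congr rfl fun k hk => hf k (Finset.mem_insert_of_mem hk) fun i hi => ?_
      exact hb i (Set.mem_biUnion (by exact hk) hi)
    · refine Set.disjoint_iUnion₂_right.2 fun k hk => ?_
      exact hT (by simp) (by simp [hk]) (by rintro rfl; exact hj hk)

theorem expect_eval [Nonempty κ] (i : ι) (F : κ → ℝ) :
    Finset.expect univ (fun b : ι → κ => F (b i)) = Finset.expect univ F := by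
  classical
  rw [Fintype.expect_eq_sum_div_card, Fintype.expect_eq_sum_div_card]
  have h : ∑ b : ι → κ, F (b i) =
      ∏ k, ∑ x, (if k = i then F x else 1) := by
    rw [Finset.prod_univ_sum, Fintype.piFinset_univ]
    refine Finset.sum_congr rfl fun b _ => ?_
    rw [Finset.prod_ite_eq' univ i fun k => F (b k)]
    simp
  rw [h, Fintype.card_pi, Finset.prod_const, Finset.card_univ]
  have h2 : ∀ k, ∑ x, (if k = i then F x else 1) =
      (Fintype.card κ : ℝ) * if k = i then (∑ x, F x) / Fintype.card κ else 1 := fun k => by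
    split_ifs
    · field_simp
    · simp
  simp only [h2]
  rw [Finset.prod_mul_distrib, Finset.prod_ite_eq' univ i fun _ => (∑ x, F x) / Fintype.card κ]
  simp

theorem dependsOn_eval {ι κ : Type*} (i : ι) (F : κ → ℝ) :
    DependsOn (fun b : ι → κ => F (b i)) {i} :=
  fun _ _ h => congrArg F (h i rfl)

end Averaging

section Collision

variable {τ : Type*} [Fintype τ] {n : ℕ} {w : τ → ℝ}

theorem sum_prod_weights (h1 : ∑ x, w x = 1) :
    ∑ D : Fin n → τ, ∏ k, w (D k) = 1 := by
  classical
  have := Finset.prod_univ_sum (fun _ : Fin n => (univ : Finset τ)) fun _ x => w x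
  rw [Fintype.piFinset_univ] at this
  rw [← this]; simp [h1]

theorem sum_prod_weights_mul (h1 : ∑ x, w x = 1) (i : Fin n) (F : τ → ℝ) :
    ∑ D : Fin n → τ, (∏ k, w (D k)) * F (D i) = ∑ x, w x * F x := by
  classical
  have := Finset.prod_univ_sum (fun _ : Fin n => (univ : Finset τ))
    fun k x => w x * if k = i then F x else 1
  rw [Fintype.piFinset_univ] at this
  simp only [Finset.prod_mul_distrib, Finset.prod_ite_eq', Finset.mem_univ, if_true] at this
  rw [← this]
  have h2 : ∀ k, ∑ x, (w x * if k = i then F x else 1) =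
      if k = i then ∑ x, w x * F x else 1 := fun k => by
    split_ifs <;> simp [h1]
  rw [Finset.prod_congr rfl fun k _ => h2 k]
  simp

theorem sum_prod_weights_mul_mul (h1 : ∑ x, w x = 1) {i j : Fin n} (hij : i ≠ j)
    (F G : τ → ℝ) :
    ∑ D : Fin n → τ, (∏ k, w (D k)) * (F (D i) * G (D j)) =
      (∑ x, w x * F x) * ∑ x, w x * G x := by
  classical
  have := Finset.prod_univ_sum (fun _ : Fin n => (univ : Finset τ))
    fun k x => w x * ((if k = i then F x else 1) * if k = j then G x else 1)
  rw [Fintype.piFinset_univ] at this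
  simp only [Finset.prod_mul_distrib, Finset.prod_ite_eq', Finset.mem_univ, if_true] at this
  rw [← this]
  have h2 : ∀ k, ∑ x, (w x * ((if k = i then F x else 1) * if k = j then G x else 1)) =
      (if k = i then ∑ x, w x * F x else 1) * if k = j then ∑ x, w x * G x else 1 := fun k => by
    by_cases hi : k = i
    · subst hi; simp [hij]
    · by_cases hj : k = j
      · subst hj; simp [hi]
      · simp [hi, hj, h1]
  rw [Finset.prod_congr rfl fun k _ => h2 k, Finset.prod_mul_distrib]
  simp

/-- Union bound for `n` i.i.d. draws `D k ∼ w`: the probability that some draw satisfies `B`, or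
that two different draws touch a common element of `Q`, where `x` touches the elements of `T x`. -/
theorem sum_prod_weights_bad_le {Q : Type*} [Fintype Q] [DecidableEq Q] (hw : ∀ x, 0 ≤ w x)
    (h1 : ∑ x, w x = 1) (T : τ → Finset Q) (B : τ → Prop) [DecidablePred B] :
    1 - ((n : ℝ) * ∑ x, w x * (if B x then 1 else 0) +
        (n : ℝ) ^ 2 * ∑ q, (∑ x, w x * if q ∈ T x then 1 else 0) ^ 2) ≤
      ∑ D : Fin n → τ, (∏ k, w (D k)) *
        (if (∀ k, ¬ B (D k)) ∧ ∀ i j, i ≠ j → Disjoint (T (D i)) (T (D j))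
          then 1 else 0) := by
  classical
  have hW : ∀ D : Fin n → τ, 0 ≤ ∏ k, w (D k) := fun D => Finset.prod_nonneg fun k _ => hw _
  have hsq : ∀ i j : Fin n, (if i ≠ j then ∑ D : Fin n → τ, (∏ k, w (D k)) *
      ∑ q, ((if q ∈ T (D i) then 1 else 0) * (if q ∈ T (D j) then 1 else 0) : ℝ) else 0) ≤
      ∑ q, (∑ x, w x * if q ∈ T x then 1 else 0) ^ 2 := fun i j => by
    split_ifs with h
    · simp only [Finset.mul_sum]
      rw [Finset.sum_comm]
      refine Finset.sum_le_sum fun q _ => le_of_eq ?_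
      rw [sum_prod_weights_mul_mul h1 h (fun x => if q ∈ T x then 1 else 0)
        (fun x => if q ∈ T x then 1 else 0), sq]
    · exact Finset.sum_nonneg fun q _ => sq_nonneg _
  have hpoint : ∀ D : Fin n → τ,
      (1 : ℝ) - (if (∀ k, ¬ B (D k)) ∧ ∀ i j, i ≠ j → Disjoint (T (D i)) (T (D j))
          then 1 else 0) ≤ ∑ i, (if B (D i) then 1 else 0) +
        ∑ i, ∑ j, if i ≠ j then
          ∑ q, ((if q ∈ T (D i) then 1 else 0) * (if q ∈ T (D j) then 1 else 0) : ℝ) else 0 :=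
      fun D => by
    have nn1 : ∀ i ∈ univ, (0 : ℝ) ≤ (if B (D i) then 1 else 0) := fun i _ => by positivity
    have nn4 : ∀ i j : Fin n, ∀ q ∈ univ, (0 : ℝ) ≤ ((if q ∈ T (D i) then 1 else 0) *
        (if q ∈ T (D j) then 1 else 0) : ℝ) := fun i j q _ => by positivity
    have nn3 : ∀ i : Fin n, ∀ j ∈ univ, (0 : ℝ) ≤ if i ≠ j then
          ∑ q, ((if q ∈ T (D i) then 1 else 0) * (if q ∈ T (D j) then 1 else 0) : ℝ) else 0 :=
      fun i j _ => by
        split_ifs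
        · exact Finset.sum_nonneg (nn4 i j)
        · exact le_rfl
    have nn2 : ∀ i ∈ univ, (0 : ℝ) ≤ ∑ j, if i ≠ j then
          ∑ q, ((if q ∈ T (D i) then 1 else 0) * (if q ∈ T (D j) then 1 else 0) : ℝ) else 0 :=
      fun i _ => Finset.sum_nonneg (nn3 i)
    split_ifs with hg
    · simpa using add_nonneg (Finset.sum_nonneg nn1) (Finset.sum_nonneg nn2)
    · rw [sub_zero]
      rcases not_and_or.1 hg with hB | hT
      · push Not at hB
        obtain ⟨k, hk⟩ := hB
        refine le_add_of_le_of_nonneg ?_ (Finset.sum_nonneg nn2)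
        refine le_trans ?_ (Finset.single_le_sum nn1 (mem_univ k))
        simp [hk]
      · simp only [not_forall] at hT
        obtain ⟨i, j, hij, hd⟩ := hT
        obtain ⟨q, hqi, hqj⟩ := Finset.not_disjoint_iff.1 hd
        refine le_add_of_nonneg_of_le (Finset.sum_nonneg nn1) ?_
        refine le_trans ?_ (Finset.single_le_sum nn2 (mem_univ i))
        refine le_trans ?_ (Finset.single_le_sum (nn3 i) (mem_univ j))
        rw [if_pos hij]
        refine le_trans ?_ (Finset.single_le_sum (nn4 i j) (mem_univ q))
        simp [hqi, hqj]
  have htot := Finset.sum_le_sum fun D (_ : D ∈ univ) =>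
    mul_le_mul_of_nonneg_left (hpoint D) (hW D)
  simp only [mul_sub, mul_one, Finset.sum_sub_distrib, sum_prod_weights h1, mul_add,
    Finset.sum_add_distrib] at htot
  have hA : ∑ D : Fin n → τ, (∏ k, w (D k)) * ∑ i, (if B (D i) then (1 : ℝ) else 0) =
      n * ∑ x, w x * (if B x then 1 else 0) := by
    simp only [Finset.mul_sum]
    rw [Finset.sum_comm]
    rw [Finset.sum_congr rfl fun i _ =>
      sum_prod_weights_mul h1 i fun x => if B x then (1 : ℝ) else 0]
    simp [Finset.mul_sum]
  have hC : ∑ D : Fin n → τ, (∏ k, w (D k)) * ∑ i, ∑ j, (if i ≠ j then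
      ∑ q, ((if q ∈ T (D i) then 1 else 0) * (if q ∈ T (D j) then 1 else 0) : ℝ) else 0) ≤
      n ^ 2 * ∑ q, (∑ x, w x * if q ∈ T x then 1 else 0) ^ 2 := by
    calc _ = ∑ i : Fin n, ∑ j : Fin n, (if i ≠ j then ∑ D : Fin n → τ, (∏ k, w (D k)) *
      ∑ q, ((if q ∈ T (D i) then 1 else 0) * (if q ∈ T (D j) then 1 else 0) : ℝ) else 0) := by
          rw [Finset.sum_congr rfl fun D _ => Finset.mul_sum _ _ _, Finset.sum_comm]
          refine Finset.sum_congr rfl fun i _ => ?_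
          rw [Finset.sum_congr rfl fun D _ => Finset.mul_sum _ _ _, Finset.sum_comm]
          refine Finset.sum_congr rfl fun j _ => ?_
          split_ifs <;> simp
      _ ≤ ∑ i : Fin n, ∑ j : Fin n, ∑ q, (∑ x, w x * if q ∈ T x then 1 else 0) ^ 2 :=
          Finset.sum_le_sum fun i _ => Finset.sum_le_sum fun j _ => hsq i j
      _ = _ := by simp; ring
  rw [hA] at htot
  linarith

end Collision

/-! ### The hard instances -/

section Weights

/-- The probability mass function with the given real weights. -/
noncomputable def PMF.ofWeights {α : Type*} [Fintype α] (f : α → ℝ) (h0 : ∀ x, 0 ≤ f x)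
    (h1 : ∑ x, f x = 1) : PMF α :=
  PMF.ofFintype (fun x => ENNReal.ofReal (f x)) (by
    rw [← ENNReal.ofReal_sum_of_nonneg fun x _ => h0 x, h1, ENNReal.ofReal_one])

end Weights

/-- The states of the hard instances, with `K` layers that consist of `M` groups of `K` states
each, and `r` unreachable states that only pad the state space. -/
inductive HState (K M r : ℕ) : Type
  /-- the only state in which the action matters -/
  | decide
  /-- an initial state from which the non-planted states of all layers are reached -/
  | explore
  /-- reward one, then `zero` -/
  | one
  /-- absorbing, without reward -/
  | zero
  /-- the state of unknown reward behind the last layer -/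
  | hidden
  /-- state `j` of group `g` in layer `l` -/
  | lay (l : Fin K) (g : Fin M) (j : Fin K)
  /-- an unreachable state -/
  | pad (k : Fin r)

namespace HState

variable {K M r : ℕ}

/-- The states as a disjoint union of finite types. -/
def equivSum : HState K M r ≃ (Fin 5 ⊕ (Fin K × Fin M × Fin K)) ⊕ Fin r where
  toFun
    | decide => .inl (.inl 0)
    | explore => .inl (.inl 1)
    | one => .inl (.inl 2)
    | zero => .inl (.inl 3)
    | hidden => .inl (.inl 4)
    | lay l g j => .inl (.inr (l, g, j))
    | pad k => .inr k
  invFun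
    | .inl (.inl 0) => decide
    | .inl (.inl 1) => explore
    | .inl (.inl 2) => one
    | .inl (.inl 3) => zero
    | .inl (.inl 4) => hidden
    | .inl (.inr (l, g, j)) => lay l g j
    | .inr k => pad k
  left_inv s := by cases s <;> rfl
  right_inv s := by
    rcases s with (i | ⟨l, g, j⟩) | k
    · fin_cases i <;> rfl
    · rfl
    · rfl

instance : Fintype (HState K M r) := Fintype.ofEquiv _ equivSum.symm

instance : DecidableEq (HState K M r) := equivSum.decidableEq

theorem card_eq : Fintype.card (HState K M r) = 5 + K * (M * K) + r := by
  rw [Fintype.card_congr equivSum]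
  simp

theorem sum_eq {E : Type*} [AddCommMonoid E] (f : HState K M r → E) :
    ∑ s, f s = f decide + f explore + f one + f zero + f hidden +
      ∑ l, ∑ g, ∑ j, f (lay l g j) + ∑ k, f (pad k) := by
  rw [← equivSum.symm.sum_comp, Fintype.sum_sum_type, Fintype.sum_sum_type, Fin.sum_univ_five,
    Fintype.sum_prod_type]
  simp only [Fintype.sum_prod_type]
  rfl

/-- The distribution with mass `x` on `one`, mass `y` on `hidden`, masses `f` on the layers and
the remaining mass on `zero`. All transitions of the hard instances have this form. -/
def row (x y : ℝ) (f : Fin K → Fin M → Fin K → ℝ) : HState K M r → ℝ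
  | one => x
  | hidden => y
  | lay l g j => f l g j
  | zero => 1 - x - y - ∑ l, ∑ g, ∑ j, f l g j
  | _ => 0

theorem sum_row_mul (x y : ℝ) (f : Fin K → Fin M → Fin K → ℝ) (h : HState K M r → ℝ) :
    ∑ t, row x y f t * h t = x * h one + y * h hidden +
      ∑ l, ∑ g, ∑ j, f l g j * h (lay l g j) +
      (1 - x - y - ∑ l, ∑ g, ∑ j, f l g j) * h zero := by
  rw [sum_eq]
  simp only [row, zero_mul, Finset.sum_const_zero]
  ring

theorem sum_row (x y : ℝ) (f : Fin K → Fin M → Fin K → ℝ) :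
    ∑ t : HState K M r, row x y f t = 1 := by
  have := sum_row_mul (r := r) x y f fun _ => 1
  simp only [mul_one] at this
  rw [this]; ring

theorem row_nonneg {x y : ℝ} {f : Fin K → Fin M → Fin K → ℝ} (hx : 0 ≤ x) (hy : 0 ≤ y)
    (hf : ∀ l g j, 0 ≤ f l g j) (h1 : x + y + ∑ l, ∑ g, ∑ j, f l g j ≤ 1)
    (t : HState K M r) : 0 ≤ row x y f t := by
  cases t <;> simp only [row, le_refl] <;> first | assumption | linarith | exact hf _ _ _

end HState

/-- The size parameters and the discount factor of the hard instances. -/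
structure HardParams where
  /-- the number of layers, and the number of states per group -/
  K : ℕ
  /-- the number of groups per layer -/
  M : ℕ
  /-- the number of unreachable states -/
  r : ℕ
  /-- the discount factor -/
  γ : ℝ
  two_le_K : 2 ≤ K
  M_pos : 0 < M
  γ_mem : γ ∈ Set.Ico (0 : ℝ) 1

namespace HardParams

noncomputable section

variable (P : HardParams)

/-- The states of the hard instances with parameters `P`. -/
abbrev St := HState P.K P.M P.r

/-- A choice of one planted state in each group of each layer. -/
abbrev Plant := Fin P.K × Fin P.M → Fin P.K

/-- The fraction of planted states. -/
def θ : ℝ := 1 / P.K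

/-- The probability of moving on to the next layer from a uniformly random state of a layer. -/
def surv : ℝ := (1 - P.θ) ^ 2

/-- The probability of moving to `one` from a uniformly random state of a layer. -/
def pay : ℝ := P.θ * (1 - P.θ)

/-- The ratio of the data masses of consecutive layers. -/
def decay : ℝ := P.surv / 2

theorem K_pos : (0 : ℝ) < P.K := by
  have := P.two_le_K
  exact_mod_cast (by omega : 0 < P.K)

theorem M_pos' : (0 : ℝ) < P.M := by exact_mod_cast P.M_pos

theorem θ_pos : 0 < P.θ := one_div_pos.2 P.K_pos

theorem θ_le : P.θ ≤ 1 / 2 := by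
  have : (2 : ℝ) ≤ P.K := by exact_mod_cast P.two_le_K
  exact one_div_le_one_div_of_le two_pos this

theorem θ_mul_K : P.θ * P.K = 1 := one_div_mul_cancel P.K_pos.ne'

theorem surv_nonneg : 0 ≤ P.surv := sq_nonneg _

theorem surv_le_one : P.surv ≤ 1 := by
  have h1 := P.θ_pos
  have h2 := P.θ_le
  unfold surv; nlinarith

theorem pay_nonneg : 0 ≤ P.pay := mul_nonneg P.θ_pos.le (by linarith [P.θ_le])

theorem pay_add_surv : P.pay + P.surv = 1 - P.θ := by unfold pay surv; ring

theorem decay_nonneg : 0 ≤ P.decay := div_nonneg P.surv_nonneg two_pos.le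

theorem decay_le : P.decay ≤ 1 / 2 := by
  unfold decay; linarith [P.surv_le_one]

theorem sum_decay_pow_le : ∑ l : Fin P.K, P.decay ^ (l : ℕ) ≤ 2 := by
  calc ∑ l : Fin P.K, P.decay ^ (l : ℕ) ≤ ∑ l : Fin P.K, (1 / 2 : ℝ) ^ (l : ℕ) :=
        Finset.sum_le_sum fun l _ => pow_le_pow_left₀ P.decay_nonneg P.decay_le _
    _ = ∑ l ∈ Finset.range P.K, (1 / 2 : ℝ) ^ l :=
        Fin.sum_univ_eq_sum_range (fun l => (1 / 2 : ℝ) ^ l) P.K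
    _ ≤ 2 := sum_geometric_two_le _

/-- The value of a state `k` layers before `hidden`, if `hidden` has reward `z`. -/
def tailVal (z : ℝ) : ℕ → ℝ
  | 0 => z
  | k + 1 => P.γ * (P.pay + P.surv * tailVal z k)

/-- The common value of all states of layer `l`, if `hidden` has reward `z`. -/
def layVal (z : ℝ) (l : ℕ) : ℝ := P.tailVal z (P.K - l)

theorem tailVal_mem (z : unitInterval) (k : ℕ) : P.tailVal z k ∈ Set.Icc (0 : ℝ) 1 := by
  induction k with
  | zero => exact z.2
  | succ k ih =>
    have h1 := P.pay_nonneg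
    have h2 := P.surv_nonneg
    have h3 := P.pay_add_surv
    have h4 := P.θ_pos
    have h5 := mul_nonneg h2 ih.1
    have h6 := mul_le_mul_of_nonneg_left ih.2 h2
    have h7 := P.γ_mem
    have h8 : P.pay + P.surv * P.tailVal z k ≤ 1 := by linarith
    exact ⟨mul_nonneg h7.1 (by linarith), mul_le_one₀ h7.2.le (by linarith) h8⟩

theorem tailVal_one_sub (k : ℕ) :
    P.tailVal 1 k - P.tailVal 0 k = (P.γ * P.surv) ^ k := by
  induction k with
  | zero => simp [tailVal]
  | succ k ih => rw [pow_succ, ← ih]; simp only [tailVal]; ring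

theorem layVal_mem (z : unitInterval) (l : ℕ) : P.layVal z l ∈ Set.Icc (0 : ℝ) 1 :=
  P.tailVal_mem z _

theorem layVal_last (z : ℝ) : P.layVal z P.K = z := by simp [layVal, tailVal]

theorem layVal_eq (z : ℝ) {l : ℕ} (h : l < P.K) :
    P.layVal z l = P.γ * (P.pay + P.surv * P.layVal z (l + 1)) := by
  unfold layVal
  obtain ⟨k, hk⟩ : ∃ k, P.K - l = k + 1 := ⟨P.K - l - 1, by omega⟩
  rw [hk, show P.K - (l + 1) = k by omega, tailVal]

/-- The probability of the transition to `one` under the safe action: it lies halfway between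
the two possible values of the first layer. -/
def safe : ℝ := (P.layVal 0 0 + P.layVal 1 0) / 2

theorem safe_mem : P.safe ∈ Set.Icc (0 : ℝ) 1 := by
  have h0 := P.layVal_mem 0 0
  have h1 := P.layVal_mem 1 0
  simp only [Set.Icc.coe_zero, Set.Icc.coe_one] at h0 h1
  constructor <;> unfold safe <;> linarith [h0.1, h0.2, h1.1, h1.2]

variable (z : unitInterval) (b : P.Plant)

/-- Transition probability to `one`. From a non-planted state it is chosen such that planted and
non-planted states of a layer have the same value. -/
def toOne : P.St → Fin 2 → ℝ
  | .decide, a => if a = 0 then 0 else P.safe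
  | .lay l g j, _ => if j = b (l, g) then P.pay + P.surv * P.layVal z (l + 1)
      else P.pay * (1 - P.layVal z (l + 1))
  | _, _ => 0

/-- Transition probability to `hidden`. -/
def toHidden : P.St → ℝ
  | .lay l g j => if j = b (l, g) then 0 else if (l : ℕ) + 1 = P.K then 1 - P.θ else 0
  | _ => 0

/-- Transition probabilities to the states of the layers. Non-planted states lead to planted
states of the next layer only. -/
def toLay : P.St → Fin 2 → Fin P.K → Fin P.M → Fin P.K → ℝ
  | .decide, a, l, _, _ => if a = 0 then if (l : ℕ) = 0 then 1 / (P.M * P.K) else 0 else 0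
  | .explore, _, l, g, j => if (l : ℕ) = 0 then 0 else if j = b (l, g) then 0
      else P.decay ^ (l : ℕ) / (2 * P.M * P.K)
  | .lay l g j, _, l', g', j' => if j = b (l, g) then 0 else if (l' : ℕ) = l + 1 then
      if j' = b (l', g') then (1 - P.θ) / P.M else 0 else 0
  | _, _, _, _, _ => 0

/-- The transition probabilities of the hard instance in which `hidden` has reward `z` and the
planted states are given by `b`. -/
def trans (s : P.St) (a : Fin 2) : P.St → ℝ :=
  HState.row (P.toOne z b s a) (P.toHidden b s) (P.toLay b s a)

theorem card_erase (j₀ : Fin P.K) (A B : ℝ) :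
    ∑ j : Fin P.K, (if j = j₀ then A else B) = A + (P.K - 1) * B := by
  have : ∀ j : Fin P.K, (if j = j₀ then A else B) = B + if j = j₀ then A - B else 0 := fun j => by
    split_ifs <;> ring
  simp only [this, Finset.sum_add_distrib, Finset.sum_ite_eq', Finset.mem_univ, if_true]
  simp; ring

theorem sum_lay_plant (A B : Fin P.K → ℝ) :
    ∑ l, ∑ g, ∑ j, (if j = b (l, g) then A l else B l) =
      ∑ l, P.M * (A l + (P.K - 1) * B l) := by
  simp only [card_erase]
  simp [mul_add]

theorem sum_next {l : ℕ} (hl : l < P.K) (G : ℕ → ℝ) :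
    (if l + 1 = P.K then G P.K else 0) + ∑ l' : Fin P.K, (if (l' : ℕ) = l + 1 then G l' else 0) =
      G (l + 1) := by
  by_cases h : l + 1 = P.K
  · rw [if_pos h, h, Finset.sum_eq_zero, add_zero]
    intro l' _
    rw [if_neg l'.2.ne]
  · rw [if_neg h, zero_add, Finset.sum_eq_single ⟨l + 1, by omega⟩]
    · simp
    · intro l' _ hl'
      rw [if_neg fun h' => hl' (Fin.ext h')]
    · simp

/-- Expectation of a function of the layer under the transition from `explore`. -/
theorem sum_toLay_explore (a : Fin 2) (G : Fin P.K → ℝ) :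
    ∑ l, ∑ g, ∑ j, P.toLay b .explore a l g j * G l =
      ∑ l : Fin P.K, if (l : ℕ) = 0 then 0 else (1 - P.θ) / 2 * P.decay ^ (l : ℕ) * G l := by
  have h := P.sum_lay_plant b (fun _ => 0)
    fun l => if (l : ℕ) = 0 then 0 else P.decay ^ (l : ℕ) / (2 * P.M * P.K) * G l
  have e : ∀ l g j, P.toLay b .explore a l g j * G l = if j = b (l, g) then 0 else
      if (l : ℕ) = 0 then 0 else P.decay ^ (l : ℕ) / (2 * P.M * P.K) * G l := fun l g j => by
    simp only [toLay]; split_ifs <;> simp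
  simp only [e]
  rw [h]
  refine Finset.sum_congr rfl fun l _ => ?_
  have := P.K_pos.ne'
  have := P.M_pos'.ne'
  split_ifs
  · simp
  · simp only [θ]; field_simp; ring

/-- Expectation of a function of the layer under the transition from a non-planted state, where
`hidden` counts as layer `K`. -/
theorem sum_toLay_lay (l : Fin P.K) (g : Fin P.M) (j : Fin P.K) (a : Fin 2) (hj : j ≠ b (l, g))
    (G : ℕ → ℝ) :
    P.toHidden b (.lay l g j) * G P.K +
      ∑ l', ∑ g', ∑ j', P.toLay b (.lay l g j) a l' g' j' * G l' = (1 - P.θ) * G (l + 1) := by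
  have h := P.sum_lay_plant b
    (fun l' => if (l' : ℕ) = l + 1 then (1 - P.θ) / P.M * G l' else 0) fun _ => 0
  have e : ∀ l' g' j', P.toLay b (.lay l g j) a l' g' j' * G l' = if j' = b (l', g') then
      if (l' : ℕ) = l + 1 then (1 - P.θ) / P.M * G l' else 0 else 0 := fun l' g' j' => by
    simp only [toLay, if_neg hj]; split_ifs <;> simp
  simp only [e]
  rw [h, ← P.sum_next l.2 fun l' => (1 - P.θ) * G l']
  simp only [toHidden, if_neg hj]
  congr 1
  · split_ifs <;> simp
  · refine Finset.sum_congr rfl fun l' _ => ?_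
    have := P.M_pos'.ne'
    split_ifs
    · field_simp; ring
    · simp

theorem sum_toLay_decide (G : Fin P.K → ℝ) :
    ∑ l, ∑ g, ∑ j, P.toLay b .decide 0 l g j * G l =
      ∑ l : Fin P.K, if (l : ℕ) = 0 then G l else 0 := by
  simp only [toLay, if_true, Finset.sum_const, Finset.card_univ, Fintype.card_fin, nsmul_eq_mul]
  refine Finset.sum_congr rfl fun l _ => ?_
  have := P.K_pos.ne'
  have := P.M_pos'.ne'
  split_ifs
  · field_simp
  · simp

theorem sum_first (G : ℕ → ℝ) : ∑ l : Fin P.K, (if (l : ℕ) = 0 then G l else 0) = G 0 := by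
  have h := P.two_le_K
  rw [Finset.sum_eq_single ⟨0, by omega⟩]
  · simp
  · intro l' _ hl'
    rw [if_neg fun h' => hl' (Fin.ext h')]
  · simp

theorem sum_toLay_of_planted (l : Fin P.K) (g : Fin P.M) (j : Fin P.K) (a : Fin 2)
    (hj : j = b (l, g)) : P.toLay b (.lay l g j) a = 0 := by
  ext l' g' j'
  simp [toLay, hj]

theorem toLay_nonneg (s : P.St) (a : Fin 2) (l : Fin P.K) (g : Fin P.M) (j : Fin P.K) :
    0 ≤ P.toLay b s a l g j := by
  have h1 := P.θ_le
  have h2 := P.decay_nonneg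
  have h3 : 0 ≤ 1 - P.θ := by linarith
  cases s <;> simp only [toLay, le_refl] <;> split_ifs <;> positivity

theorem toHidden_nonneg (s : P.St) : 0 ≤ P.toHidden b s := by
  have h1 := P.θ_le
  have h3 : 0 ≤ 1 - P.θ := by linarith
  cases s <;> simp only [toHidden, le_refl]
  split_ifs <;> positivity

theorem toOne_nonneg (s : P.St) (a : Fin 2) : 0 ≤ P.toOne z b s a := by
  have h1 := P.pay_nonneg
  have h2 := P.surv_nonneg
  have h3 := P.safe_mem.1
  cases s with
  | lay l g j =>
    have h4 := (P.layVal_mem z (l + 1))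
    have h5 : 0 ≤ 1 - P.layVal z (l + 1) := by linarith [h4.2]
    have h6 := h4.1
    simp only [toOne]; split_ifs <;> positivity
  | decide => simp only [toOne]; split_ifs <;> first | exact le_rfl | exact h3
  | _ => simp only [toOne, le_refl]

theorem trans_total_le (s : P.St) (a : Fin 2) :
    P.toOne z b s a + P.toHidden b s + ∑ l, ∑ g, ∑ j, P.toLay b s a l g j ≤ 1 := by
  have h1 := P.θ_le
  have h2 := P.θ_pos
  cases s with
  | decide =>
    by_cases ha : a = 0
    · subst ha
      have := P.sum_toLay_decide b fun _ => 1
      simp only [mul_one] at this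
      rw [this, P.sum_first fun _ => 1]
      simp [toOne, toHidden]
    · have := P.safe_mem.2
      simpa [toOne, toHidden, toLay, ha]
  | explore =>
    have := P.sum_toLay_explore b a fun _ => 1
    simp only [mul_one] at this
    rw [this]
    simp only [toOne, toHidden, add_zero, zero_add]
    calc _ ≤ ∑ l : Fin P.K, (1 - P.θ) / 2 * P.decay ^ (l : ℕ) :=
          Finset.sum_le_sum fun l _ => by
            have := P.decay_nonneg
            have h3 : 0 ≤ 1 - P.θ := by linarith
            split_ifs
            · positivity
            · exact le_rfl
      _ ≤ 1 := by
        rw [← Finset.mul_sum]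
        nlinarith [P.sum_decay_pow_le]
  | lay l g j =>
    have h4 := P.layVal_mem z (l + 1)
    have h5 := P.pay_nonneg
    have h6 := P.surv_nonneg
    have h7 := P.pay_add_surv
    by_cases hj : j = b (l, g)
    · rw [P.sum_toLay_of_planted b l g j a hj]
      simp only [toOne, toHidden, if_pos hj]
      simp
      nlinarith [h4.2]
    · have := P.sum_toLay_lay b l g j a hj fun _ => 1
      simp only [mul_one] at this
      rw [add_assoc, this]
      simp only [toOne, if_neg hj]
      have : P.pay * (1 - P.layVal z (l + 1)) ≤ P.pay := by nlinarith [h4.1]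
      have : P.pay ≤ P.θ := by unfold pay; nlinarith
      linarith
  | _ => simp [toOne, toHidden, toLay]

theorem trans_nonneg (s : P.St) (a : Fin 2) (t : P.St) : 0 ≤ P.trans z b s a t :=
  HState.row_nonneg (P.toOne_nonneg z b s a) (P.toHidden_nonneg b s) (P.toLay_nonneg b s a)
    (P.trans_total_le z b s a) t

theorem sum_trans (s : P.St) (a : Fin 2) : ∑ t, P.trans z b s a t = 1 := HState.sum_row _ _ _

/-- The reward function: one in `one`, and `z` in `hidden`. -/
def reward : P.St → ℝ
  | .one => 1
  | .hidden => z
  | _ => 0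

theorem reward_mem (s : P.St) : P.reward z s ∈ Set.Icc (0 : ℝ) 1 := by
  cases s <;> simp [reward]

/-- Initial probabilities. The states `one` and `zero` are included so that the data cover them
at no cost. -/
def init : P.St → ℝ
  | .decide | .explore | .one | .zero => 1 / 4
  | _ => 0

theorem init_nonneg (s : P.St) : 0 ≤ P.init s := by cases s <;> simp [init]

theorem sum_init : ∑ s, P.init s = 1 := by
  rw [HState.sum_eq]; simp only [init]; simp; norm_num

variable {σ : Type*} [Fintype σ] (e : σ ≃ P.St)

/-- The initial distribution on a state space that is identified with `P.St`. -/
def initPMF : PMF σ := PMF.ofWeights (fun s => P.init (e s)) (fun _ => P.init_nonneg _)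
  ((Equiv.sum_comp e _).trans P.sum_init)

/-- The hard instance with reward `z` in `hidden` and planted states `b`, on a state space that
is identified with `P.St`. -/
def mdp : MDP σ (Fin 2) where
  P s a := PMF.ofWeights (fun t => P.trans z b (e s) a (e t)) (fun _ => P.trans_nonneg z b _ _ _)
    ((Equiv.sum_comp e _).trans (P.sum_trans z b _ _))
  R s _ := P.reward z (e s)
  R_mem _ _ := P.reward_mem z _
  γ := P.γ
  γ_mem := P.γ_mem
  d₀ := P.initPMF e

/-- The value of the states other than `decide`, which does not depend on the policy. -/
def val (z : ℝ) : P.St → ℝ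
  | .one => 1
  | .hidden => z
  | .lay l _ _ => P.layVal z l
  | .explore => P.γ * ∑ l : Fin P.K, if (l : ℕ) = 0 then 0
      else (1 - P.θ) / 2 * P.decay ^ (l : ℕ) * P.layVal z l
  | _ => 0

/-- The common `Q`-function of all policies. -/
def qFun (z : ℝ) : P.St → Fin 2 → ℝ
  | .decide, a => if a = 0 then P.γ * P.layVal z 0 else P.γ * P.safe
  | s, _ => P.val z s

/-- The Bellman equation: as `decide` is never entered, only the values off `decide` matter. -/
theorem qFun_eq (s : P.St) (a : Fin 2) (h : P.St → ℝ)
    (hh : ∀ t, t ≠ .decide → h t = P.val z t) :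
    P.qFun z s a = P.reward z s + P.γ * ∑ t, P.trans z b s a t * h t := by
  rw [trans, HState.sum_row_mul, hh .one (by simp), hh .hidden (by simp), hh .zero (by simp),
    Finset.sum_congr rfl fun l _ => Finset.sum_congr rfl fun g _ => Finset.sum_congr rfl fun j _ =>
      congrArg _ (hh (.lay l g j) (by simp))]
  simp only [val]
  cases s with
  | decide =>
    by_cases ha : a = 0
    · subst ha
      rw [P.sum_toLay_decide b fun l => P.layVal z l, P.sum_first fun l => P.layVal z l]
      simp [toOne, toHidden, reward, qFun]
    · simp [toOne, toHidden, reward, qFun, toLay, ha]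
  | explore =>
    rw [P.sum_toLay_explore b a fun l => P.layVal z l]
    simp [toOne, toHidden, reward, qFun, val]
  | lay l g j =>
    have h5 := P.layVal_eq z l.2
    by_cases hj : j = b (l, g)
    · rw [P.sum_toLay_of_planted b l g j a hj]
      simp only [toOne, toHidden, if_pos hj, reward, qFun, val, h5]
      simp
    · have := P.sum_toLay_lay b l g j a hj fun l => P.layVal z l
      rw [P.layVal_last] at this
      rw [add_assoc (P.toOne z b _ a * 1), this]
      simp only [toOne, if_neg hj, reward, qFun, val, h5, pay, surv]
      ring
  | _ => simp [toOne, toHidden, reward, qFun, val, toLay]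

end

end HardParams

/-! ### Values and regret -/

namespace HardParams

noncomputable section

variable (P : HardParams) (z : unitInterval) (b : P.Plant)
  {σ : Type*} [Fintype σ] (e : σ ≃ P.St)

theorem mdp_P_toReal (s : σ) (a : Fin 2) (t : σ) :
    ((P.mdp z b e).P s a t).toReal = P.trans z b (e s) a (e t) :=
  ENNReal.toReal_ofReal (P.trans_nonneg z b _ _ _)

theorem mdp_d₀_toReal (s : σ) : ((P.mdp z b e).d₀ s).toReal = P.init (e s) :=
  ENNReal.toReal_ofReal (P.init_nonneg _)

theorem sum_joinAction_mul (p : PMF σ) (π : Policy σ (Fin 2)) (f : σ × Fin 2 → ℝ) :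
    ∑ y, (MDP.joinAction p π y).toReal * f y =
      ∑ t, (p t).toReal * ∑ a, (π t a).toReal * f (t, a) := by
  rw [Fintype.sum_prod_type]
  refine Finset.sum_congr rfl fun t _ => ?_
  rw [Finset.mul_sum]
  refine Finset.sum_congr rfl fun a _ => ?_
  rw [MDP.joinAction_apply, ENNReal.toReal_mul, mul_assoc]

theorem qFun_of_ne {s : P.St} (hs : s ≠ .decide) (z : ℝ) (a : Fin 2) :
    P.qFun z s a = P.val z s := by
  cases s <;> first | rfl | exact absurd rfl hs

theorem sum_policy_mul_qFun {σ : Type*} (e : σ ≃ P.St) (π : Policy σ (Fin 2)) (t : P.St) (ht : t ≠ .decide) (z : ℝ) :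
    ∑ a, (π (e.symm t) a).toReal * P.qFun z t a = P.val z t := by
  simp only [P.qFun_of_ne ht, ← Finset.sum_mul, MDP.sum_toReal_eq_one, one_mul]

variable [MeasurableSpace σ] [MeasurableSingletonClass σ]

/-- The expected return from any initial law of state and action. -/
theorem mdp_return (π : Policy σ (Fin 2)) (ρ : PMF (σ × Fin 2)) :
    ∫ ω, (P.mdp z b e).discountedReturn ω ∂((P.mdp z b e).trajFrom (fun _ => π) ρ) =
      ∑ x, (ρ x).toReal * P.qFun z (e x.1) x.2 := by
  refine MDP.integral_discountedReturn_of_bellman _ π ρ (fun x => P.qFun z (e x.1) x.2) ?_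
  rintro ⟨s, a⟩
  rw [sum_joinAction_mul]
  simp only [mdp_P_toReal]
  rw [P.qFun_eq z b (e s) a (fun t => ∑ a, (π (e.symm t) a).toReal * P.qFun z t a)
    fun t ht => P.sum_policy_mul_qFun e π t ht z]
  rw [← Equiv.sum_comp e]
  simp [mdp]

theorem mdp_Q (π : Policy σ (Fin 2)) :
    (P.mdp z b e).Q π = fun s a => P.qFun z (e s) a := by
  classical
  ext s a
  rw [MDP.Q, mdp_return, Finset.sum_eq_single (s, a)]
  · simp
  · intro y _ hy
    simp [PMF.pure_apply, hy]
  · simp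

theorem mdp_V (π : Policy σ (Fin 2)) (s : σ) :
    (P.mdp z b e).V π s = ∑ a, (π s a).toReal * P.qFun z (e s) a := by
  classical
  rw [MDP.V, mdp_return, sum_joinAction_mul, Finset.sum_eq_single s]
  · simp
  · intro y _ hy
    simp [PMF.pure_apply, hy]
  · simp

theorem mdp_J (π : Policy σ (Fin 2)) :
    (P.mdp z b e).J π = (P.γ * P.safe + P.val z .explore + 1) / 4 +
      P.γ * (P.layVal z 0 - P.safe) / 4 * (π (e.symm .decide) 0).toReal := by
  rw [MDP.J, MDP.traj, mdp_return, sum_joinAction_mul]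
  simp only [mdp_d₀_toReal]
  rw [← e.symm.sum_comp, HState.sum_eq]
  simp only [Equiv.apply_symm_apply, init, zero_mul, Finset.sum_const_zero]
  rw [P.sum_policy_mul_qFun e π .explore (by simp), P.sum_policy_mul_qFun e π .one (by simp),
    P.sum_policy_mul_qFun e π .zero (by simp)]
  have h := MDP.sum_toReal_eq_one (π (e.symm .decide))
  rw [Fin.sum_univ_two] at h
  rw [Fin.sum_univ_two, show (π (e.symm .decide) 1).toReal = 1 - (π (e.symm .decide) 0).toReal by
    linarith]
  simp only [qFun, val]
  simp
  ring

theorem mdp_isOptimal (a' : Fin 2) (h : ∀ a, P.qFun z .decide a ≤ P.qFun z .decide a') :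
    (P.mdp z b e).IsOptimal fun _ => a' := by
  classical
  intro π s
  rw [mdp_V, mdp_V]
  have h1 : ∑ a, (MDP.detPolicy (fun _ : σ => a') s a).toReal * P.qFun z (e s) a =
      P.qFun z (e s) a' := by
    rw [Finset.sum_eq_single a']
    · simp [MDP.detPolicy]
    · intro a _ ha
      simp [MDP.detPolicy, PMF.pure_apply, ha]
    · simp
  rw [h1]
  have h2 : ∀ a, P.qFun z (e s) a ≤ P.qFun z (e s) a' := fun a => by
    by_cases hs : e s = .decide
    · rw [hs]; exact h a
    · rw [P.qFun_of_ne hs, P.qFun_of_ne hs]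
  calc _ ≤ ∑ a, (π s a).toReal * P.qFun z (e s) a' :=
        Finset.sum_le_sum fun a _ => mul_le_mul_of_nonneg_left (h2 a) ENNReal.toReal_nonneg
    _ = _ := by rw [← Finset.sum_mul, MDP.sum_toReal_eq_one, one_mul]

/-- The loss in return of the wrong action in `decide`: the probability `1 / 4` of `decide`, times
the discount factor, times half the difference of the two possible values of the first layer. -/
def gap : ℝ := P.γ * (P.γ * P.surv) ^ P.K / 8

theorem layVal_one_sub_safe : P.γ * (P.layVal 1 0 - P.safe) / 4 = P.gap := by
  have h := P.tailVal_one_sub P.K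
  simp only [gap, safe, layVal, Nat.sub_zero, ← h]
  ring

theorem layVal_zero_sub_safe : P.γ * (P.layVal 0 0 - P.safe) / 4 = -P.gap := by
  have h := P.tailVal_one_sub P.K
  simp only [gap, safe, layVal, Nat.sub_zero, ← h]
  ring

theorem gap_nonneg : 0 ≤ P.gap := by
  have := P.γ_mem.1
  have := P.surv_nonneg
  unfold gap; positivity

theorem mdp_one_isOptimal : (P.mdp 1 b e).IsOptimal fun _ => 0 := by
  refine P.mdp_isOptimal 1 b e 0 fun a => ?_
  have := P.layVal_one_sub_safe
  have := P.gap_nonneg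
  simp only [qFun, if_true, Set.Icc.coe_one]
  split_ifs <;> linarith

theorem mdp_zero_isOptimal : (P.mdp 0 b e).IsOptimal fun _ => 1 := by
  refine P.mdp_isOptimal 0 b e 1 fun a => ?_
  have := P.layVal_zero_sub_safe
  have := P.gap_nonneg
  simp only [qFun, if_neg one_ne_zero, Set.Icc.coe_zero]
  split_ifs <;> linarith

theorem mdp_one_regret (π : Policy σ (Fin 2)) :
    (P.mdp 1 b e).J (MDP.detPolicy fun _ => 0) - (P.mdp 1 b e).J π =
      P.gap * (1 - (π (e.symm .decide) 0).toReal) := by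
  rw [mdp_J, mdp_J, Set.Icc.coe_one, layVal_one_sub_safe]
  simp [MDP.detPolicy]
  ring

theorem mdp_zero_regret (π : Policy σ (Fin 2)) :
    (P.mdp 0 b e).J (MDP.detPolicy fun _ => 1) - (P.mdp 0 b e).J π =
      P.gap * (π (e.symm .decide) 0).toReal := by
  rw [mdp_J, mdp_J, Set.Icc.coe_zero, layVal_zero_sub_safe]
  simp [MDP.detPolicy]

end

end HardParams

/-! ### The discounted occupancy of the uniform policy -/

namespace MDP

variable {S A : Type*}

/-- The law of `s_h` under the policy `π`. -/
noncomputable def stateLaw (M : MDP S A) (π : ℕ → Policy S A) : ℕ → PMF S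
  | 0 => M.d₀
  | h + 1 => (stateLaw M π h).bind fun s => (π h s).bind fun a => M.P s a

theorem stateActionLaw_eq (M : MDP S A) (π : ℕ → Policy S A) (h : ℕ) :
    M.stateActionLaw π (joinAction M.d₀ (π 0)) h = joinAction (M.stateLaw π h) (π h) := by
  induction h with
  | zero => rfl
  | succ h ih =>
    rw [stateActionLaw, ih, stateLaw]
    simp [joinAction, PMF.bind_bind, PMF.bind_map, Function.comp_def]

theorem stateLaw_succ_toReal [Fintype S] [Fintype A] (M : MDP S A) (π : ℕ → Policy S A) (h : ℕ)
    (t : S) : (M.stateLaw π (h + 1) t).toReal =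
      ∑ s, (M.stateLaw π h s).toReal * ∑ a, (π h s a).toReal * (M.P s a t).toReal := by
  rw [stateLaw, toReal_bind_apply]
  simp only [toReal_bind_apply]

end MDP

namespace HardParams

noncomputable section

variable (P : HardParams) (z : unitInterval) (b : P.Plant)

/-- The ratio of the weights of consecutive times in the data distribution. The value `1 / (2 * K)`
makes the data masses of consecutive layers decay by the factor `decay ≤ 1 / 2`. -/
def rate : ℝ := P.θ / 2

theorem rate_pos : 0 < P.rate := half_pos P.θ_pos

theorem rate_le : P.rate ≤ 1 / 4 := by
  unfold rate; linarith [P.θ_le]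

/-- The mass of layer `l` under `stateMass`. -/
def layMass (l : ℕ) : ℝ := (1 - P.rate) / 8 * P.decay ^ l

/-- The normalized discounted state occupancy, with discount `rate` and starting at time one, of the uniform
policy. It is the same for all hard instances. -/
def stateMass : P.St → ℝ :=
  HState.row ((1 - P.rate) * P.safe / 8 + P.rate * P.pay * ∑ l : Fin P.K, P.layMass l)
    (P.θ * P.layMass P.K) fun l _ _ => P.layMass l / (P.M * P.K)

theorem layMass_nonneg (l : ℕ) : 0 ≤ P.layMass l :=
  mul_nonneg (by linarith [P.rate_le]) (pow_nonneg P.decay_nonneg _)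

theorem sum_layMass_le : ∑ l : Fin P.K, P.layMass l ≤ 1 / 4 := by
  simp only [layMass, ← Finset.mul_sum]
  have h0 : 0 ≤ ∑ l : Fin P.K, P.decay ^ (l : ℕ) :=
    Finset.sum_nonneg fun l _ => pow_nonneg P.decay_nonneg _
  nlinarith [P.sum_decay_pow_le, P.rate_pos]

theorem sum_lay_const (A : Fin P.K → ℝ) :
    ∑ l : Fin P.K, ∑ _g : Fin P.M, ∑ _j : Fin P.K, A l / (P.M * P.K) = ∑ l, A l := by
  have := P.K_pos.ne'
  have := P.M_pos'.ne'
  refine Finset.sum_congr rfl fun l _ => ?_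
  simp
  field_simp

theorem layMass_le (l : ℕ) : P.layMass l ≤ 1 / 8 * (1 / 2) ^ l := by
  unfold layMass
  have h1 := pow_le_pow_left₀ P.decay_nonneg P.decay_le l
  have h2 := pow_nonneg P.decay_nonneg l
  have h3 := P.rate_pos
  have h4 := P.rate_le
  nlinarith

theorem stateMass_nonneg (s : P.St) : 0 ≤ P.stateMass s := by
  have h1 := P.rate_pos
  have h2 := P.rate_le
  have h3 := P.pay_nonneg
  have h4 := P.safe_mem
  have h5 : 0 ≤ ∑ l : Fin P.K, P.layMass l := Finset.sum_nonneg fun l _ => P.layMass_nonneg _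
  have h6 := P.sum_layMass_le
  have h7 : 0 ≤ 1 - P.rate := by linarith
  have h8 := h4.1
  have h9 := P.θ_pos.le
  have hK := P.layMass_nonneg P.K
  have hK' : P.layMass P.K ≤ 1 / 8 := (P.layMass_le _).trans
    (mul_le_of_le_one_right (by norm_num) (pow_le_one₀ (by norm_num) (by norm_num)))
  refine HState.row_nonneg (by positivity) (by positivity)
    (fun l _ _ => div_nonneg (P.layMass_nonneg _) (by positivity)) ?_ s
  rw [P.sum_lay_const fun l => P.layMass l]
  have h10 : P.pay ≤ 1 := by linarith [P.pay_add_surv, P.surv_nonneg, P.θ_pos]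
  have h11 : P.rate * P.pay ≤ 1 := by nlinarith
  have h12 : P.rate * P.pay * ∑ l : Fin P.K, P.layMass l ≤ 1 / 4 := by nlinarith
  have h13 : (1 - P.rate) * P.safe ≤ 1 := by nlinarith [h4.2]
  have h14 : P.θ * P.layMass P.K ≤ 1 / 8 := by nlinarith [P.θ_le]
  linarith

theorem sum_stateMass : ∑ s, P.stateMass s = 1 := HState.sum_row _ _ _

/-- The state transition probabilities of the uniform policy. -/
def avgTrans (s t : P.St) : ℝ := (P.trans z b s 0 t + P.trans z b s 1 t) / 2

theorem avgTrans_nonneg (s t : P.St) : 0 ≤ P.avgTrans z b s t :=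
  div_nonneg (add_nonneg (P.trans_nonneg _ _ _ _ _) (P.trans_nonneg _ _ _ _ _)) two_pos.le

theorem sum_avgTrans (s : P.St) : ∑ t, P.avgTrans z b s t = 1 := by
  simp only [avgTrans, ← Finset.sum_div, Finset.sum_add_distrib, sum_trans]
  norm_num

theorem sum_layMass_mul (A B : Fin P.K → ℝ) :
    ∑ l : Fin P.K, ∑ g, ∑ j, P.layMass l / (P.M * P.K) * (if j = b (l, g) then A l else B l) =
      ∑ l : Fin P.K, P.layMass l * (P.θ * A l + (1 - P.θ) * B l) := by
  have h := P.sum_lay_plant b (fun l => P.layMass l / (P.M * P.K) * A l)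
    fun l => P.layMass l / (P.M * P.K) * B l
  simp only [mul_ite]
  rw [h]
  refine Finset.sum_congr rfl fun l _ => ?_
  have := P.K_pos.ne'
  have := P.M_pos'.ne'
  simp only [θ]
  field_simp

theorem sum_stateMass_mul (f : P.St → ℝ) (A B : Fin P.K → ℝ) (h1 : f .one = 0)
    (h2 : f .hidden = 0) (h3 : f .zero = 0)
    (h4 : ∀ l g j, f (.lay l g j) = if j = b (l, g) then A l else B l) :
    ∑ s, P.stateMass s * f s = ∑ l : Fin P.K, P.layMass l * (P.θ * A l + (1 - P.θ) * B l) := by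
  rw [stateMass, HState.sum_row_mul, h1, h2, h3, ← P.sum_layMass_mul b]
  simp [h4]

theorem sum_init_mul (f : P.St → ℝ) (h1 : f .one = 0) (h3 : f .zero = 0) :
    ∑ s, P.init s * f s = (f .decide + f .explore) / 4 := by
  rw [HState.sum_eq, h1, h3]
  simp only [init, zero_mul, Finset.sum_const_zero]
  ring

theorem sum_prev (l : Fin P.K) (G : ℕ → ℝ) :
    ∑ l' : Fin P.K, (if (l : ℕ) = l' + 1 then G l' else 0) =
      if (l : ℕ) = 0 then 0 else G (l - 1) := by
  split_ifs with h
  · exact Finset.sum_eq_zero fun l' _ => if_neg (by omega)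
  · rw [Finset.sum_eq_single ⟨l - 1, by omega⟩]
    · rw [if_pos (by simp; omega)]
    · intro l' _ hl'
      exact if_neg fun h' => hl' (Fin.ext (by simp; omega))
    · simp

theorem sum_last (G : ℕ → ℝ) :
    ∑ l' : Fin P.K, (if (l' : ℕ) + 1 = P.K then G l' else 0) = G (P.K - 1) := by
  have h := P.two_le_K
  rw [Finset.sum_eq_single ⟨P.K - 1, by omega⟩]
  · rw [if_pos (by simp; omega)]
  · intro l' _ hl'
    exact if_neg fun h' => hl' (Fin.ext (by simp; omega))
  · simp

theorem layMass_succ (l : ℕ) : P.θ * P.layMass (l + 1) = P.rate * P.surv * P.layMass l := by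
  simp only [layMass, rate, decay, pow_succ]; ring

/-- The flow equation of the discounted occupancy. From layer `l`, the uniform policy enters only
planted states of layer `l + 1`; the entry from `explore` restores uniformity on the layer. -/
theorem stateMass_flow (t : P.St) :
    P.stateMass t = (1 - P.rate) * ∑ s, P.init s * P.avgTrans z b s t +
      P.rate * ∑ s, P.stateMass s * P.avgTrans z b s t := by
  classical
  have hK := P.K_pos.ne'
  have hM := P.M_pos'.ne'
  have main : ∀ t : P.St, t ≠ .zero →
      P.stateMass t = (1 - P.rate) * ∑ s, P.init s * P.avgTrans z b s t +
        P.rate * ∑ s, P.stateMass s * P.avgTrans z b s t := by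
    intro t ht
    cases t with
    | zero => exact absurd rfl ht
    | one =>
      rw [P.sum_init_mul _ (by simp [avgTrans, trans, toOne, HState.row])
        (by simp [avgTrans, trans, toOne, HState.row]),
        P.sum_stateMass_mul b _ (fun l => P.pay + P.surv * P.layVal z (l + 1))
          (fun l => P.pay * (1 - P.layVal z (l + 1)))
          (by simp [avgTrans, trans, toOne, HState.row])
          (by simp [avgTrans, trans, toOne, HState.row])
          (by simp [avgTrans, trans, toOne, HState.row])
          (fun l g j => by simp [avgTrans, trans, toOne, HState.row])]
      have : ∀ l : Fin P.K, P.layMass l * (P.θ * (P.pay + P.surv * P.layVal z (l + 1)) +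
          (1 - P.θ) * (P.pay * (1 - P.layVal z (l + 1)))) = P.pay * P.layMass l := fun l => by
        unfold pay surv; ring
      simp only [this, ← Finset.mul_sum]
      simp [stateMass, avgTrans, trans, toOne, HState.row]
      ring
    | hidden =>
      rw [P.sum_init_mul _ (by simp [avgTrans, trans, toHidden, HState.row])
        (by simp [avgTrans, trans, toHidden, HState.row]),
        P.sum_stateMass_mul b _ (fun l => 0) (fun l => if (l : ℕ) + 1 = P.K then 1 - P.θ else 0)
          (by simp [avgTrans, trans, toHidden, HState.row])
          (by simp [avgTrans, trans, toHidden, HState.row])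
          (by simp [avgTrans, trans, toHidden, HState.row])
          (fun l g j => by simp [avgTrans, trans, toHidden, HState.row])]
      have : ∀ l : Fin P.K, P.layMass l * (P.θ * 0 +
          (1 - P.θ) * (if (l : ℕ) + 1 = P.K then 1 - P.θ else 0)) =
          if (l : ℕ) + 1 = P.K then P.surv * P.layMass l else 0 := fun l => by
        unfold surv; split_ifs <;> ring
      simp only [this]
      rw [P.sum_last fun l => P.surv * P.layMass l]
      have h2 := P.two_le_K
      have h3 := P.layMass_succ (P.K - 1)
      rw [show P.K - 1 + 1 = P.K by omega] at h3
      simp [stateMass, avgTrans, trans, toHidden, HState.row]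
      linarith
    | lay l g j =>
      rw [P.sum_init_mul _ (by simp [avgTrans, trans, toLay, HState.row])
        (by simp [avgTrans, trans, toLay, HState.row]),
        P.sum_stateMass_mul b _ (fun l => 0)
          (fun l' => if (l : ℕ) = l' + 1 then if j = b (l, g) then (1 - P.θ) / P.M else 0 else 0)
          (by simp [avgTrans, trans, toLay, HState.row])
          (by simp [avgTrans, trans, toLay, HState.row])
          (by simp [avgTrans, trans, toLay, HState.row])
          (fun l' g' j' => by simp [avgTrans, trans, toLay, HState.row])]
      have : ∀ l' : Fin P.K, P.layMass l' * (P.θ * 0 + (1 - P.θ) * (if (l : ℕ) = l' + 1 then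
          if j = b (l, g) then (1 - P.θ) / P.M else 0 else 0)) =
          if (l : ℕ) = l' + 1 then if j = b (l, g) then P.surv * P.layMass l' / P.M else 0
            else 0 := fun l' => by
        unfold surv; split_ifs <;> ring
      simp only [this]
      rw [P.sum_prev l fun l' => if j = b (l, g) then P.surv * P.layMass l' / P.M else 0]
      by_cases hl : (l : ℕ) = 0
      · simp [stateMass, avgTrans, trans, toLay, HState.row, hl, layMass]
        field_simp
        ring
      · have h3 := P.layMass_succ (l - 1)
        rw [show (l : ℕ) - 1 + 1 = l by omega] at h3
        by_cases hj : j = b (l, g)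
        · simp [stateMass, avgTrans, trans, toLay, HState.row, hl, hj]
          rw [mul_div_assoc', ← mul_assoc, ← h3, θ]
          field_simp
        · simp [stateMass, avgTrans, trans, toLay, HState.row, hl, hj, layMass]
          field_simp
          ring
    | _ => simp [stateMass, avgTrans, trans, HState.row]
  by_cases ht : t = .zero
  · subst ht
    have e1 : ∑ t, P.stateMass t = ∑ t, ((1 - P.rate) * ∑ s, P.init s * P.avgTrans z b s t +
        P.rate * ∑ s, P.stateMass s * P.avgTrans z b s t) := by
      rw [Finset.sum_add_distrib, ← Finset.mul_sum, ← Finset.mul_sum, Finset.sum_comm,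
        Finset.sum_comm (f := fun t s => P.stateMass s * P.avgTrans z b s t)]
      simp only [← Finset.mul_sum, sum_avgTrans, mul_one, sum_stateMass, sum_init]
      ring
    rw [← Finset.add_sum_erase _ _ (mem_univ HState.zero),
      ← Finset.add_sum_erase _ (fun t => (1 - P.rate) * ∑ s, P.init s * P.avgTrans z b s t +
        P.rate * ∑ s, P.stateMass s * P.avgTrans z b s t) (mem_univ HState.zero),
      Finset.sum_congr rfl fun t ht => main t (Finset.ne_of_mem_erase ht)] at e1
    exact add_right_cancel e1
  · exact main t ht

end

end HardParams

/-! ### Admissibility and concentrability of the data -/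

namespace HardParams

noncomputable section

variable (P : HardParams) (z : unitInterval) (b : P.Plant)
  {σ : Type*} [Fintype σ] (e : σ ≃ P.St)

/-- The data distribution: the state is drawn from the equal mixture of `init` and `stateMass`,
the action is uniform. -/
def data : PMF (σ × Fin 2) :=
  PMF.ofWeights (fun x => (P.init (e x.1) + P.stateMass (e x.1)) / 4)
    (fun _ => div_nonneg (add_nonneg (P.init_nonneg _) (P.stateMass_nonneg _)) (by norm_num)) (by
      rw [Fintype.sum_prod_type]
      simp only [Finset.sum_const, Finset.card_univ, Fintype.card_fin, nsmul_eq_mul]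
      rw [← Finset.mul_sum, Equiv.sum_comp e fun s => (P.init s + P.stateMass s) / 4,
        ← Finset.sum_div, Finset.sum_add_distrib, sum_init, sum_stateMass]
      norm_num)

theorem data_toReal (x : σ × Fin 2) :
    (P.data e x).toReal = (P.init (e x.1) + P.stateMass (e x.1)) / 4 :=
  ENNReal.toReal_ofReal (div_nonneg (add_nonneg (P.init_nonneg _) (P.stateMass_nonneg _))
    (by norm_num))

/-- The policy that always picks a uniformly random action. -/
def uniformPolicy (σ : Type*) : Policy σ (Fin 2) := fun _ => PMF.uniformOfFintype (Fin 2)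

theorem uniformPolicy_toReal {σ : Type*} (s : σ) (a : Fin 2) :
    (uniformPolicy σ s a).toReal = 1 / 2 := by
  simp [uniformPolicy]

/-- State probabilities at time `h` under the uniform policy. -/
def uniformState (h : ℕ) (t : σ) : ℝ :=
  ((P.mdp z b e).stateLaw (fun _ => uniformPolicy σ) h t).toReal

theorem uniformState_zero (t : σ) : P.uniformState z b e 0 t = P.init (e t) :=
  P.mdp_d₀_toReal z b e t

theorem uniformState_succ (h : ℕ) (t : σ) : P.uniformState z b e (h + 1) t =
    ∑ s, P.uniformState z b e h s * P.avgTrans z b (e s) (e t) := by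
  rw [uniformState, MDP.stateLaw_succ_toReal]
  refine Finset.sum_congr rfl fun s _ => ?_
  simp only [uniformPolicy_toReal, mdp_P_toReal, Fin.sum_univ_two, avgTrans, uniformState]
  ring

theorem uniformState_nonneg (h : ℕ) (t : σ) : 0 ≤ P.uniformState z b e h t :=
  ENNReal.toReal_nonneg

/-- What remains of `stateMass` after subtracting the first `H` times is nonnegative with total mass
`rate ^ H`: by the flow equation, each further time transports the remainder by one step. -/
theorem stateMass_sub_partial (H : ℕ) :
    (∀ t, 0 ≤ P.stateMass (e t) - ∑ h ∈ Finset.range H,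
      (1 - P.rate) * P.rate ^ h * P.uniformState z b e (h + 1) t) ∧
    ∑ t, (P.stateMass (e t) - ∑ h ∈ Finset.range H,
      (1 - P.rate) * P.rate ^ h * P.uniformState z b e (h + 1) t) = P.rate ^ H := by
  induction H with
  | zero =>
    refine ⟨fun t => by simpa using P.stateMass_nonneg _, ?_⟩
    simpa using (Equiv.sum_comp e P.stateMass).trans P.sum_stateMass
  | succ H ih =>
    have step : ∀ t, P.stateMass (e t) - ∑ h ∈ Finset.range (H + 1),
        (1 - P.rate) * P.rate ^ h * P.uniformState z b e (h + 1) t =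
        P.rate * ∑ s, (P.stateMass (e s) - ∑ h ∈ Finset.range H,
          (1 - P.rate) * P.rate ^ h * P.uniformState z b e (h + 1) s) *
            P.avgTrans z b (e s) (e t) := fun t => by
      have e1 := P.stateMass_flow z b (e t)
      rw [← Equiv.sum_comp e, ← Equiv.sum_comp e
        fun s => P.stateMass s * P.avgTrans z b s (e t)] at e1
      simp only [← P.uniformState_zero z b e, ← uniformState_succ] at e1
      have e2 : ∑ s, (∑ h ∈ Finset.range H,
          (1 - P.rate) * P.rate ^ h * P.uniformState z b e (h + 1) s) *
            P.avgTrans z b (e s) (e t) =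
          ∑ h ∈ Finset.range H, (1 - P.rate) * P.rate ^ h * P.uniformState z b e (h + 2) t := by
        simp only [Finset.sum_mul]
        rw [Finset.sum_comm]
        refine Finset.sum_congr rfl fun h _ => ?_
        rw [P.uniformState_succ z b e (h + 1), Finset.mul_sum]
        simp only [mul_assoc]
      rw [Finset.sum_congr rfl fun s _ => sub_mul _ _ _, Finset.sum_sub_distrib, e2, mul_sub, e1, Finset.sum_range_succ', Finset.mul_sum (s := Finset.range H)]
      have e3 : ∀ h, P.rate * ((1 - P.rate) * P.rate ^ h * P.uniformState z b e (h + 2) t) =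
          (1 - P.rate) * P.rate ^ (h + 1) * P.uniformState z b e (h + 1 + 1) t := fun h => by
        rw [pow_succ]; ring
      simp only [e3]
      ring
    constructor
    · intro t
      rw [step]
      exact mul_nonneg P.rate_pos.le (Finset.sum_nonneg fun s _ =>
        mul_nonneg (ih.1 s) (P.avgTrans_nonneg _ _ _ _))
    · simp only [step]
      rw [← Finset.mul_sum, Finset.sum_comm]
      simp only [← Finset.mul_sum]
      have : ∀ s, ∑ t, P.avgTrans z b (e s) (e t) = 1 := fun s =>
        (Equiv.sum_comp e _).trans (P.sum_avgTrans z b (e s))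
      simp only [this, mul_one, ih.2]
      ring

theorem hasSum_stateMass (t : σ) :
    HasSum (fun h => (1 - P.rate) * P.rate ^ h * P.uniformState z b e (h + 1) t)
      (P.stateMass (e t)) := by
  have h1 := P.rate_pos
  have h2 := P.rate_le
  rw [hasSum_iff_tendsto_nat_of_nonneg fun h => mul_nonneg
    (mul_nonneg (by linarith) (pow_nonneg h1.le _)) (P.uniformState_nonneg z b e _ _)]
  have key : Filter.Tendsto (fun H => P.stateMass (e t) - ∑ h ∈ Finset.range H,
      (1 - P.rate) * P.rate ^ h * P.uniformState z b e (h + 1) t) Filter.atTop (nhds 0) := by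
    refine squeeze_zero (fun H => (P.stateMass_sub_partial z b e H).1 t) (fun H => ?_)
      (tendsto_pow_atTop_nhds_zero_of_lt_one h1.le (by linarith : P.rate < 1))
    rw [← (P.stateMass_sub_partial z b e H).2]
    exact Finset.single_le_sum (fun s _ => (P.stateMass_sub_partial z b e H).1 s) (mem_univ t)
  simpa using key.const_sub (P.stateMass (e t))

/-- The weights of the times in the data distribution. -/
def timeWeight : ℕ → ℝ
  | 0 => 1 / 2
  | h + 1 => (1 - P.rate) * P.rate ^ h / 2

theorem timeWeight_nonneg (h : ℕ) : 0 ≤ P.timeWeight h := by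
  have h1 := P.rate_pos
  have h2 := P.rate_le
  have h3 : 0 ≤ 1 - P.rate := by linarith
  cases h <;> simp only [timeWeight] <;> positivity

theorem hasSum_timeWeight : HasSum P.timeWeight 1 := by
  have h1 := P.rate_pos
  have h2 := P.rate_le
  rw [← hasSum_nat_add_iff' 1]
  have := ((hasSum_geometric_of_lt_one h1.le (by linarith)).mul_left (1 - P.rate)).div_const 2
  rw [mul_inv_cancel₀ (by linarith : (1 - P.rate) ≠ 0)] at this
  simpa [timeWeight, show (1 : ℝ) - 2⁻¹ = 1 / 2 by norm_num] using this

theorem hasSum_data (x : σ × Fin 2) :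
    HasSum (fun h => P.timeWeight h * (P.uniformState z b e h x.1 * (1 / 2)))
      (P.data e x).toReal := by
  have e1 : (fun h => P.timeWeight (h + 1) * (P.uniformState z b e (h + 1) x.1 * (1 / 2))) =
      fun h => (1 - P.rate) * P.rate ^ h * P.uniformState z b e (h + 1) x.1 / 4 := by
    funext h
    simp only [timeWeight]
    ring
  have e2 : (P.data e x).toReal - ∑ h ∈ Finset.range 1,
      P.timeWeight h * (P.uniformState z b e h x.1 * (1 / 2)) = P.stateMass (e x.1) / 4 := by
    rw [Finset.sum_range_one, data_toReal, uniformState_zero, timeWeight]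
    ring
  rw [← hasSum_nat_add_iff' 1, e1, e2]
  exact (P.hasSum_stateMass z b e x.1).div_const 4

/-- An upper bound for the number of steps until the process is in `one` or `zero`. -/
def rank : P.St → ℕ
  | .decide | .explore => 3
  | .lay l g j => if j = b (l, g) then 1 else 2
  | .hidden | .pad _ => 1
  | .one | .zero => 0

theorem rank_le_of_trans_ne_zero {s t : P.St} {a : Fin 2} (h : P.trans z b s a t ≠ 0) :
    P.rank b t ≤ P.rank b s - 1 := by
  revert h
  cases s <;> cases t <;>
    simp only [trans, HState.row, toOne, toHidden, toLay, rank] <;> (try split_ifs) <;> (try simp)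

theorem avgTrans_eq_trans {s : P.St} (hs : s ≠ .decide) (a : Fin 2) (t : P.St) :
    P.avgTrans z b s t = P.trans z b s a t := by
  have : ∀ a a', P.trans z b s a t = P.trans z b s a' t := fun a a' => by
    cases s <;> first | rfl | exact absurd rfl hs
  rw [avgTrans, this 0 a, this 1 a]
  ring

section StateLaw

variable (π : ℕ → Policy σ (Fin 2))

theorem stateLaw_succ (h : ℕ) (t : σ) :
    ((P.mdp z b e).stateLaw π (h + 1) t).toReal =
      ∑ s, ((P.mdp z b e).stateLaw π h s).toReal *
        ∑ a, (π h s a).toReal * P.trans z b (e s) a (e t) := by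
  rw [MDP.stateLaw_succ_toReal]
  simp only [mdp_P_toReal]

theorem rank_le_of_stateLaw_ne_zero (h : ℕ) (t : σ)
    (ht : ((P.mdp z b e).stateLaw π h t).toReal ≠ 0) : P.rank b (e t) ≤ 3 - h := by
  induction h generalizing t with
  | zero =>
    generalize e t = s
    cases s <;> simp only [rank] <;> (try split_ifs) <;> omega
  | succ h ih =>
    rw [stateLaw_succ] at ht
    obtain ⟨s, -, hs⟩ := Finset.exists_ne_zero_of_sum_ne_zero ht
    obtain ⟨a, -, ha⟩ := Finset.exists_ne_zero_of_sum_ne_zero (right_ne_zero_of_mul hs)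
    have h1 := ih s (left_ne_zero_of_mul hs)
    have h2 := P.rank_le_of_trans_ne_zero z b (right_ne_zero_of_mul ha)
    omega

theorem policy_le_one (p : PMF (Fin 2)) (a : Fin 2) : (p a).toReal ≤ 1 :=
  ENNReal.toReal_le_of_le_ofReal zero_le_one (by simpa using p.coe_le_one a)

theorem sum_policy_trans_le (p : PMF (Fin 2)) (s t : P.St) :
    ∑ a, (p a).toReal * P.trans z b s a t ≤ 2 * P.avgTrans z b s t := by
  rw [Fin.sum_univ_two, avgTrans]
  have h0 := mul_le_mul_of_nonneg_right (policy_le_one p 0) (P.trans_nonneg z b s 0 t)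
  have h1 := mul_le_mul_of_nonneg_right (policy_le_one p 1) (P.trans_nonneg z b s 1 t)
  linarith

theorem sum_policy_trans_eq (p : PMF (Fin 2)) {s : P.St} (hs : s ≠ .decide) (t : P.St) :
    ∑ a, (p a).toReal * P.trans z b s a t = P.avgTrans z b s t := by
  have := MDP.sum_toReal_eq_one p
  rw [← one_mul (P.avgTrans z b s t), ← this, Finset.sum_mul]
  exact Finset.sum_congr rfl fun a _ => by rw [P.avgTrans_eq_trans z b hs a]

theorem stateLaw_one_le (t : σ) :
    (1 - P.rate) * ((P.mdp z b e).stateLaw π 1 t).toReal ≤ 2 * P.stateMass (e t) := by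
  have h2 := P.rate_le
  have h3 : ((P.mdp z b e).stateLaw π 1 t).toReal ≤
      2 * ∑ s, P.init s * P.avgTrans z b s (e t) := by
    rw [stateLaw_succ, Finset.mul_sum, ← Equiv.sum_comp e]
    refine Finset.sum_le_sum fun s _ => ?_
    rw [MDP.stateLaw, mdp_d₀_toReal, mul_left_comm]
    exact mul_le_mul_of_nonneg_left (P.sum_policy_trans_le z b _ _ _) (P.init_nonneg _)
  have h4 : 0 ≤ P.rate * ∑ s, P.stateMass s * P.avgTrans z b s (e t) :=
    mul_nonneg P.rate_pos.le (Finset.sum_nonneg fun s _ =>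
      mul_nonneg (P.stateMass_nonneg s) (P.avgTrans_nonneg _ _ _ _))
  have h5 := P.stateMass_flow z b (e t)
  nlinarith

theorem stateLaw_two_le (t : σ) :
    (1 - P.rate) * P.rate * ((P.mdp z b e).stateLaw π 2 t).toReal ≤ 2 * P.stateMass (e t) := by
  have h2 := P.rate_le
  have h3 : (1 - P.rate) * ((P.mdp z b e).stateLaw π 2 t).toReal ≤
      2 * ∑ s, P.stateMass s * P.avgTrans z b s (e t) := by
    rw [stateLaw_succ, Finset.mul_sum, Finset.mul_sum, ← Equiv.sum_comp e]
    refine Finset.sum_le_sum fun s _ => ?_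
    by_cases hs : e s = .decide
    · have : ((P.mdp z b e).stateLaw π 1 s).toReal = 0 := by
        by_contra h
        have := P.rank_le_of_stateLaw_ne_zero z b e π 1 s h
        rw [hs] at this
        simp [rank] at this
      rw [this, zero_mul, mul_zero]
      exact mul_nonneg two_pos.le (mul_nonneg (P.stateMass_nonneg _) (P.avgTrans_nonneg _ _ _ _))
    · rw [P.sum_policy_trans_eq z b _ hs, ← mul_assoc, ← mul_assoc]
      exact mul_le_mul_of_nonneg_right (P.stateLaw_one_le z b e π s) (P.avgTrans_nonneg _ _ _ _)
  have h4 : 0 ≤ (1 - P.rate) * ∑ s, P.init s * P.avgTrans z b s (e t) :=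
    mul_nonneg (by linarith) (Finset.sum_nonneg fun s _ =>
      mul_nonneg (P.init_nonneg s) (P.avgTrans_nonneg _ _ _ _))
  have h5 := P.stateMass_flow z b (e t)
  have h6 := mul_le_mul_of_nonneg_left h3 P.rate_pos.le
  nlinarith

/-- Every state law is dominated by the data. At time one, the uniform policy reaches each state with
at least half the probability of any other policy; at time two, where actions have no effect any
more, the flow equation loses another factor `rate`; later only `one` and `zero` are reached, which
have initial mass `1 / 4`. -/
theorem stateLaw_le (h : ℕ) (t : σ) :
    ((P.mdp z b e).stateLaw π h t).toReal ≤ 8 * P.K * (P.init (e t) + P.stateMass (e t)) := by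
  have hK : (2 : ℝ) ≤ P.K := by exact_mod_cast P.two_le_K
  have h1 := P.init_nonneg (e t)
  have h2 := P.stateMass_nonneg (e t)
  have h3 := P.rate_le
  have h4 := P.rate_pos
  have h5 : P.rate * P.K = 1 / 2 := by
    have := P.θ_mul_K
    unfold rate; linarith
  have h6 : 0 ≤ ((P.mdp z b e).stateLaw π h t).toReal := ENNReal.toReal_nonneg
  match h, h6 with
  | 0, _ =>
    rw [MDP.stateLaw, mdp_d₀_toReal]
    nlinarith
  | 1, h6 =>
    have := P.stateLaw_one_le z b e π t
    nlinarith
  | 2, h6 =>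
    have := P.stateLaw_two_le z b e π t
    have h7 : 3 / 4 * (P.rate * ((P.mdp z b e).stateLaw π 2 t).toReal) ≤
        2 * P.stateMass (e t) := by
      have := mul_nonneg h4.le h6
      nlinarith
    have h8 : 3 / 4 * (P.rate * P.K * ((P.mdp z b e).stateLaw π 2 t).toReal) ≤
        2 * P.K * P.stateMass (e t) := by
      have := mul_le_mul_of_nonneg_left h7 P.K_pos.le
      linarith
    rw [h5] at h8
    nlinarith
  | h + 3, h6 =>
    by_cases h0 : ((P.mdp z b e).stateLaw π (h + 3) t).toReal = 0
    · rw [h0]; positivity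
    · have h7 := P.rank_le_of_stateLaw_ne_zero z b e π (h + 3) t h0
      have h8 : P.init (e t) = 1 / 4 := by
        revert h7
        generalize e t = s
        cases s <;> simp only [rank, init] <;> (try split_ifs) <;> simp
      have h9 : ((P.mdp z b e).stateLaw π (h + 3) t).toReal ≤ 1 :=
        ENNReal.toReal_le_of_le_ofReal zero_le_one
          (by simpa using ((P.mdp z b e).stateLaw π (h + 3)).coe_le_one t)
      rw [h8]
      nlinarith

end StateLaw

variable [MeasurableSpace σ] [MeasurableSingletonClass σ]

/-- The data distribution is the mixture, over the times `h` with weights `timeWeight`, of the laws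
of `(s_h, a_h)` under the uniform policy. -/
theorem isAdmissibleMixture_data : (P.mdp z b e).IsAdmissibleMixture (P.data e) := by
  let w : PMF ℕ := ⟨fun h => ENNReal.ofReal (P.timeWeight h), by
    have := ENNReal.ofReal_tsum_of_nonneg P.timeWeight_nonneg P.hasSum_timeWeight.summable
    rw [P.hasSum_timeWeight.tsum_eq, ENNReal.ofReal_one] at this
    rw [this]
    exact ENNReal.summable.hasSum⟩
  let law : ℕ → PMF (σ × Fin 2) := fun h =>
    MDP.joinAction ((P.mdp z b e).stateLaw (fun _ => uniformPolicy σ) h) (uniformPolicy σ)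
  refine ⟨w.map law, fun ν hν => ?_, ?_⟩
  · rw [PMF.mem_support_map_iff] at hν
    obtain ⟨h, -, rfl⟩ := hν
    rw [MDP.admissible_iff]
    exact ⟨fun _ => uniformPolicy σ, h, ((P.mdp z b e).stateActionLaw_eq _ h).symm⟩
  · rw [PMF.bind_map]
    refine PMF.ext fun x => ?_
    obtain ⟨s, a⟩ := x
    have hs := P.hasSum_data z b e (s, a)
    rw [← ENNReal.ofReal_toReal ((P.data e).apply_ne_top (s, a)), ← hs.tsum_eq,
      ENNReal.ofReal_tsum_of_nonneg (fun h => mul_nonneg (P.timeWeight_nonneg h)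
        (mul_nonneg (P.uniformState_nonneg z b e _ _) (by norm_num))) hs.summable,
      PMF.bind_apply]
    refine tsum_congr fun h => ?_
    rw [ENNReal.ofReal_mul (P.timeWeight_nonneg h), ← uniformPolicy_toReal s a, uniformState,
      ← ENNReal.toReal_mul, ENNReal.ofReal_toReal (ENNReal.mul_ne_top (PMF.apply_ne_top _ _)
        (PMF.apply_ne_top _ _)), ← MDP.joinAction_apply]
    rfl

theorem concCoeff_data_le {C : ℝ} (hC : 32 * P.K ≤ C) :
    (P.mdp z b e).concCoeff (P.data e) ≤ ENNReal.ofReal C := by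
  refine iSup_le fun ν => iSup_le fun hν => iSup_le fun x => ?_
  obtain ⟨π, h, rfl⟩ := ((P.mdp z b e).admissible_iff ν).1 hν
  obtain ⟨s, a⟩ := x
  have hC0 : 0 ≤ C := le_trans (mul_nonneg (by norm_num) P.K_pos.le) hC
  refine ENNReal.div_le_of_le_mul ?_
  rw [MDP.stateActionLaw_eq, MDP.joinAction_apply]
  refine (ENNReal.toReal_le_toReal (ENNReal.mul_ne_top (PMF.apply_ne_top _ _)
    (PMF.apply_ne_top _ _)) (ENNReal.mul_ne_top ENNReal.ofReal_ne_top
    (PMF.apply_ne_top _ _))).1 ?_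
  rw [ENNReal.toReal_mul, ENNReal.toReal_mul, data_toReal, ENNReal.toReal_ofReal hC0]
  have h1 := P.stateLaw_le z b e π h s
  have h2 := policy_le_one (π h s) a
  have h3 : 0 ≤ ((P.mdp z b e).stateLaw π h s).toReal := ENNReal.toReal_nonneg
  have h4 := add_nonneg (P.init_nonneg (e s)) (P.stateMass_nonneg (e s))
  have h5 := mul_le_mul_of_nonneg_right hC h4
  have h6 := mul_le_of_le_one_right h3 h2
  dsimp only
  linarith

end

end HardParams

/-! ### Transitions averaged over the planted states -/

namespace HardParams

noncomputable section

variable (P : HardParams) (z : unitInterval) (b : P.Plant)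

instance : Nonempty (Fin P.K) := ⟨⟨0, by have := P.two_le_K; omega⟩⟩

/-- Mean transition probability to `one` over a uniformly random choice of planted states. -/
def refOne : P.St → Fin 2 → ℝ
  | .decide, a => if a = 0 then 0 else P.safe
  | .lay _ _ _, _ => P.pay
  | _, _ => 0

/-- Mean transition probability to `hidden` over a uniformly random choice of planted states. -/
def refHidden : P.St → ℝ
  | .lay l _ _ => if (l : ℕ) + 1 = P.K then P.surv else 0
  | _ => 0

/-- Mean transition probability to layer `l` over a uniformly random choice of planted states. -/
def refLayer : P.St → Fin 2 → Fin P.K → ℝ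
  | .decide, a, l => if a = 0 then if (l : ℕ) = 0 then 1 else 0 else 0
  | .explore, _, l => if (l : ℕ) = 0 then 0 else (1 - P.θ) / 2 * P.decay ^ (l : ℕ)
  | .lay l _ _, _, l' => if (l' : ℕ) = l + 1 then P.surv else 0
  | _, _, _ => 0

/-- The mean of the transition probabilities over a uniformly random choice of planted states.
It does not depend on the reward of `hidden`. -/
def refTrans (s : P.St) (a : Fin 2) : P.St → ℝ :=
  HState.row (P.refOne s a) (P.refHidden s) fun l _ _ => P.refLayer s a l / (P.M * P.K)

theorem expect_plant (l : Fin P.K) (g : Fin P.M) (j : Fin P.K) (A B : ℝ) :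
    Finset.expect univ (fun b : P.Plant => if j = b (l, g) then A else B) =
      P.θ * A + (1 - P.θ) * B := by
  rw [expect_eval (l, g) fun j' => if j = j' then A else B, Fintype.expect_eq_sum_div_card]
  have := P.card_erase j A B
  simp only [eq_comm (b := j)] at this
  have hK := P.K_pos.ne'
  simp only [this, Fintype.card_fin, θ]
  field_simp

theorem expect_toOne (s : P.St) (a : Fin 2) :
    Finset.expect univ (fun b => P.toOne z b s a) = P.refOne s a := by
  cases s with
  | lay l g j =>
    simp only [toOne, expect_plant, refOne, pay, surv]
    ring
  | _ => simp [toOne, refOne]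

theorem expect_toHidden (s : P.St) :
    Finset.expect univ (fun b => P.toHidden b s) = P.refHidden s := by
  cases s with
  | lay l g j =>
    simp only [toHidden, expect_plant, refHidden, surv]
    split_ifs <;> ring
  | _ => simp [toHidden, refHidden]

theorem expect_toLay (s : P.St) (a : Fin 2) (l : Fin P.K) (g : Fin P.M) (j : Fin P.K) :
    Finset.expect univ (fun b => P.toLay b s a l g j) = P.refLayer s a l / (P.M * P.K) := by
  have hK := P.K_pos.ne'
  have hM := P.M_pos'.ne'
  cases s with
  | decide => simp [toLay, refLayer]; split_ifs <;> simp
  | explore =>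
    simp only [toLay, refLayer]
    split_ifs
    · simp
    · rw [expect_plant]; field_simp; ring
  | lay l₀ g₀ j₀ =>
    simp only [toLay, refLayer]
    split_ifs with h
    · have e1 : ∀ b : P.Plant, (if j₀ = b (l₀, g₀) then 0 else if j = b (l, g) then
          (1 - P.θ) / P.M else 0) = (if j₀ = b (l₀, g₀) then (0 : ℝ) else 1) *
          (if j = b (l, g) then (1 - P.θ) / P.M else 0) := fun b => by split_ifs <;> simp
      simp only [e1]
      rw [expect_mul_of_dependsOn
        (dependsOn_eval (l₀, g₀) fun x => if j₀ = x then (0 : ℝ) else 1)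
        (dependsOn_eval (l, g) fun x => if j = x then (1 - P.θ) / P.M else 0),
        expect_plant, expect_plant]
      · simp only [surv, θ]; field_simp; ring
      · rw [Set.disjoint_singleton, Ne, Prod.mk.injEq]
        rintro ⟨rfl, -⟩
        omega
    · simp
  | _ => simp [toLay, refLayer]

theorem expect_trans (s : P.St) (a : Fin 2) (t : P.St) :
    Finset.expect univ (fun b => P.trans z b s a t) = P.refTrans s a t := by
  cases t with
  | one => exact P.expect_toOne z s a
  | hidden => exact P.expect_toHidden s
  | lay l g j => exact P.expect_toLay s a l g j
  | zero =>
    simp only [trans, refTrans, HState.row, Finset.expect_sub_distrib, Finset.expect_sum_comm,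
      expect_toOne, expect_toHidden, expect_toLay]
    simp
  | _ => simp [trans, refTrans, HState.row]

theorem refTrans_nonneg (s : P.St) (a : Fin 2) (t : P.St) : 0 ≤ P.refTrans s a t := by
  rw [← P.expect_trans 0]
  exact Finset.expect_nonneg fun b _ => P.trans_nonneg _ _ _ _ _

theorem sum_refTrans (s : P.St) (a : Fin 2) : ∑ t, P.refTrans s a t = 1 := HState.sum_row _ _ _

/-- The group that a state belongs to, if any. -/
def group : P.St → Finset (Fin P.K × Fin P.M)
  | .lay l g _ => {(l, g)}
  | _ => ∅

/-- The transition probability from `s` to `t` depends on the planted states only through the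
groups of `s` and `t`. -/
theorem trans_dependsOn (s : P.St) (a : Fin 2) (t : P.St) :
    DependsOn (fun b => P.trans z b s a t)
      ((P.group s ∪ P.group t : Finset (Fin P.K × Fin P.M)) : Set (Fin P.K × Fin P.M)) := by
  intro b b' hb
  have hs : P.toOne z b s a = P.toOne z b' s a ∧ P.toHidden b s = P.toHidden b' s := by
    cases s with
    | lay l g j =>
      have := hb (l, g) (by simp [group])
      simp only [toOne, toHidden, this, and_self]
    | _ => exact ⟨rfl, rfl⟩
  cases t with
  | one => exact hs.1
  | hidden => exact hs.2
  | lay l g j =>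
    have h1 := hb (l, g) (by simp [group])
    cases s with
    | lay l₀ g₀ j₀ =>
      have h2 := hb (l₀, g₀) (by simp [group])
      simp only [trans, HState.row, toLay, h1, h2]
    | _ => simp only [trans, HState.row, toLay, h1]
  | zero =>
    -- The total mass on the layers does not depend on which states are planted.
    have h3 : P.toHidden b s + ∑ l, ∑ g, ∑ j, P.toLay b s a l g j =
        P.toHidden b' s + ∑ l, ∑ g, ∑ j, P.toLay b' s a l g j := by
      cases s with
      | explore =>
        have e1 := P.sum_toLay_explore b a fun _ => 1
        have e2 := P.sum_toLay_explore b' a fun _ => 1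
        simp only [mul_one] at e1 e2
        rw [e1, e2]
        rfl
      | lay l g j =>
        have h2 := hb (l, g) (by simp [group])
        by_cases hj : j = b (l, g)
        · rw [P.sum_toLay_of_planted b l g j a hj, P.sum_toLay_of_planted b' l g j a (h2 ▸ hj)]
          rw [hs.2]
        · have e1 := P.sum_toLay_lay b l g j a hj fun _ => 1
          have e2 := P.sum_toLay_lay b' l g j a (h2 ▸ hj) fun _ => 1
          simp only [mul_one] at e1 e2
          rw [e1, e2]
      | _ => rfl
    simp only [trans, HState.row, hs.1, hs.2] at h3 ⊢
    linarith
  | _ => rfl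

variable {σ : Type*} [Fintype σ] (e : σ ≃ P.St)

/-- The probability of the sample `(s, a, s')` if the transitions are averaged over the choice of
the planted states. -/
def refWeight (x : σ × Fin 2 × σ) : ℝ :=
  (P.data e (x.1, x.2.1)).toReal * P.refTrans (e x.1) x.2.1 (e x.2.2)

/-- The groups that the states of a sample belong to. -/
def touched (x : σ × Fin 2 × σ) : Finset (Fin P.K × Fin P.M) :=
  P.group (e x.1) ∪ P.group (e x.2.2)

theorem refWeight_nonneg (x : σ × Fin 2 × σ) : 0 ≤ P.refWeight e x :=
  mul_nonneg ENNReal.toReal_nonneg (P.refTrans_nonneg _ _ _)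

theorem sum_refWeight_mul (f : P.St → Fin 2 → P.St → ℝ) :
    ∑ x : σ × Fin 2 × σ, P.refWeight e x * f (e x.1) x.2.1 (e x.2.2) =
      ∑ s, ∑ a, (P.init s + P.stateMass s) / 4 * ∑ t, P.refTrans s a t * f s a t := by
  simp only [Fintype.sum_prod_type, refWeight, data_toReal]
  rw [← Equiv.sum_comp e]
  refine Finset.sum_congr rfl fun s _ => Finset.sum_congr rfl fun a _ => ?_
  rw [← Equiv.sum_comp e, Finset.mul_sum]
  simp only [mul_assoc]

theorem sum_refWeight : ∑ x : σ × Fin 2 × σ, P.refWeight e x = 1 := by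
  have := P.sum_refWeight_mul e fun _ _ _ => 1
  simp only [mul_one, sum_refTrans] at this
  rw [this]
  simp only [Finset.sum_const, Finset.card_univ, Fintype.card_fin, nsmul_eq_mul]
  rw [← Finset.mul_sum, ← Finset.sum_div, Finset.sum_add_distrib, sum_init, sum_stateMass]
  norm_num

theorem sum_refWeight_hidden_le :
    ∑ x : σ × Fin 2 × σ, P.refWeight e x * (if e x.1 = .hidden then 1 else 0) ≤
      (1 / 2) ^ P.K / 32 := by
  rw [P.sum_refWeight_mul e fun s _ _ => if s = .hidden then 1 else 0]
  simp only [← Finset.sum_mul, sum_refTrans, one_mul]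
  rw [Finset.sum_eq_single .hidden]
  · have h1 := P.layMass_le P.K
    have h2 := P.layMass_nonneg P.K
    have h3 := P.θ_le
    have h4 : P.θ * P.layMass P.K ≤ 1 / 2 * (1 / 8 * (1 / 2) ^ P.K) :=
      mul_le_mul h3 h1 h2 (by norm_num)
    simp [init, stateMass, HState.row]
    simp at h4
    linarith
  · intro s _ hs
    simp [hs]
  · simp

theorem sum_refWeight_group_le (l : Fin P.K) (g : Fin P.M) :
    ∑ x : σ × Fin 2 × σ, P.refWeight e x * (if (l, g) ∈ P.touched e x then 1 else 0) ≤
      (P.layMass l + ∑ s, ∑ a, (P.init s + P.stateMass s) / 4 * P.refLayer s a l) / P.M := by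
  have hK := P.K_pos.ne'
  have hM := P.M_pos'.ne'
  have h1 : ∑ x : σ × Fin 2 × σ, P.refWeight e x * (if (l, g) ∈ P.touched e x then 1 else 0) ≤
      ∑ x : σ × Fin 2 × σ, P.refWeight e x * (if (l, g) ∈ P.group (e x.1) then 1 else 0) +
      ∑ x : σ × Fin 2 × σ, P.refWeight e x * (if (l, g) ∈ P.group (e x.2.2) then 1 else 0) := by
    rw [← Finset.sum_add_distrib]
    refine Finset.sum_le_sum fun x _ => ?_
    rw [← mul_add]
    refine mul_le_mul_of_nonneg_left ?_ (P.refWeight_nonneg e x)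
    simp only [touched, Finset.mem_union]
    by_cases hs : (l, g) ∈ P.group (e x.1) <;> by_cases ht : (l, g) ∈ P.group (e x.2.2) <;>
      simp [hs, ht]
  have hg : ∀ l' g' j', (l, g) ∈ P.group (.lay l' g' j') ↔ l' = l ∧ g' = g := fun l' g' j' => by
    simp [group, eq_comm]
  have hsum : ∀ G : Fin P.K → ℝ, ∑ l' : Fin P.K, ∑ g' : Fin P.M, ∑ _j' : Fin P.K,
      G l' / (P.M * P.K) * (if l' = l ∧ g' = g then 1 else 0) = G l / P.M := fun G => by
    rw [Finset.sum_eq_single l]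
    · rw [Finset.sum_eq_single g]
      · simp; field_simp
      · intro g' _ hg'; simp [hg']
      · simp
    · intro l' _ hl'; simp [hl']
    · simp
  have h2 : ∑ x : σ × Fin 2 × σ, P.refWeight e x * (if (l, g) ∈ P.group (e x.1) then 1 else 0) =
      P.layMass l / P.M / 2 := by
    rw [P.sum_refWeight_mul e fun s _ _ => if (l, g) ∈ P.group s then 1 else 0]
    simp only [← Finset.sum_mul, sum_refTrans, one_mul, Finset.sum_const, Finset.card_univ,
      Fintype.card_fin, nsmul_eq_mul]
    rw [HState.sum_eq]
    simp only [hg, init, stateMass, HState.row]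
    simp only [group, Finset.notMem_empty, if_false, mul_zero, Finset.sum_const_zero, zero_add,
      add_zero]
    rw [← hsum fun l => P.layMass l]
    simp only [Finset.sum_div]
    refine Finset.sum_congr rfl fun _ _ => Finset.sum_congr rfl fun _ _ =>
      Finset.sum_congr rfl fun _ _ => ?_
    push_cast
    ring
  have h3 : ∑ x : σ × Fin 2 × σ, P.refWeight e x *
      (if (l, g) ∈ P.group (e x.2.2) then 1 else 0) =
      (∑ s, ∑ a, (P.init s + P.stateMass s) / 4 * P.refLayer s a l) / P.M := by
    rw [P.sum_refWeight_mul e fun _ _ t => if (l, g) ∈ P.group t then 1 else 0]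
    simp only [Finset.sum_div]
    refine Finset.sum_congr rfl fun s _ => Finset.sum_congr rfl fun a _ => ?_
    rw [refTrans, HState.sum_row_mul]
    simp only [hg]
    rw [hsum]
    simp [group]
    ring
  rw [h2, h3] at h1
  have h4 : P.layMass l / P.M / 2 ≤ P.layMass l / P.M :=
    half_le_self (div_nonneg (P.layMass_nonneg _) P.M_pos'.le)
  rw [add_div]
  linarith

theorem refLayer_nonneg (s : P.St) (a : Fin 2) (l : Fin P.K) : 0 ≤ P.refLayer s a l := by
  have h := P.expect_toLay s a l ⟨0, P.M_pos⟩ (Classical.arbitrary _)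
  have h2 : 0 ≤ P.refLayer s a l / (P.M * P.K) := by
    rw [← h]; exact Finset.expect_nonneg fun b _ => P.toLay_nonneg _ _ _ _ _ _
  have := mul_nonneg h2 (mul_nonneg P.M_pos'.le P.K_pos.le)
  rwa [div_mul_cancel₀ _ (mul_pos P.M_pos' P.K_pos).ne'] at this

theorem sum_refLayer_le (s : P.St) (a : Fin 2) : ∑ l, P.refLayer s a l ≤ 1 := by
  have h0 := P.refTrans_nonneg s a .zero
  have h1 := P.refTrans_nonneg s a .one
  have h2 := P.refTrans_nonneg s a .hidden
  simp only [refTrans, HState.row] at h0 h1 h2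
  rw [P.sum_lay_const fun l => P.refLayer s a l] at h0
  linarith

/-- The collision probability of two samples is of order `1 / M`. -/
theorem sum_sq_refWeight_group_le :
    ∑ q, (∑ x : σ × Fin 2 × σ, P.refWeight e x * (if q ∈ P.touched e x then 1 else 0)) ^ 2 ≤
      4 / P.M := by
  have hM := P.M_pos'
  set G : Fin P.K → ℝ := fun l =>
    P.layMass l + ∑ s, ∑ a, (P.init s + P.stateMass s) / 4 * P.refLayer s a l with hG
  have hw : ∀ s, 0 ≤ (P.init s + P.stateMass s) / 4 := fun s =>
    div_nonneg (add_nonneg (P.init_nonneg s) (P.stateMass_nonneg s)) (by norm_num)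
  have hG0 : ∀ l, 0 ≤ G l := fun l => add_nonneg (P.layMass_nonneg _)
    (Finset.sum_nonneg fun s _ => Finset.sum_nonneg fun a _ =>
      mul_nonneg (hw s) (P.refLayer_nonneg s a l))
  have hG1 : ∑ l, G l ≤ 2 := by
    have h1 : ∑ l : Fin P.K, ∑ s, ∑ a, (P.init s + P.stateMass s) / 4 * P.refLayer s a l ≤ 1 := by
      rw [Finset.sum_comm]
      have : ∀ s, ∑ l, ∑ a, (P.init s + P.stateMass s) / 4 * P.refLayer s a l ≤
          (P.init s + P.stateMass s) / 2 := fun s => by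
        rw [Finset.sum_comm, Fin.sum_univ_two, ← Finset.mul_sum, ← Finset.mul_sum]
        have e1 := mul_le_mul_of_nonneg_left (P.sum_refLayer_le s 0) (hw s)
        have e2 := mul_le_mul_of_nonneg_left (P.sum_refLayer_le s 1) (hw s)
        linarith
      refine (Finset.sum_le_sum fun s _ => this s).trans ?_
      rw [← Finset.sum_div, Finset.sum_add_distrib, sum_init, sum_stateMass]
      norm_num
    rw [Finset.sum_add_distrib]
    linarith [P.sum_layMass_le]
  calc _ ≤ ∑ q : Fin P.K × Fin P.M, (G q.1 / P.M) ^ 2 := by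
        refine Finset.sum_le_sum fun q _ => ?_
        refine pow_le_pow_left₀ (Finset.sum_nonneg fun x _ =>
          mul_nonneg (P.refWeight_nonneg e x) (by positivity)) ?_ 2
        exact P.sum_refWeight_group_le e q.1 q.2
    _ = (∑ l, G l ^ 2) / P.M := by
        rw [Fintype.sum_prod_type, Finset.sum_div]
        refine Finset.sum_congr rfl fun l _ => ?_
        simp
        field_simp
    _ ≤ (∑ l, G l) ^ 2 / P.M := by
        gcongr
        exact Finset.sum_sq_le_sq_sum_of_nonneg fun l _ => hG0 l
    _ ≤ 4 / P.M := by
        gcongr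
        have := Finset.sum_nonneg fun l (_ : l ∈ univ) => hG0 l
        nlinarith

end

end HardParams

/-! ### Datasets and the two-point argument -/

namespace MDP

variable {S A : Type*}

/-- The law of `(s, a, s')` in one sample. -/
noncomputable def tripleLaw (M : MDP S A) (μ : PMF (S × A)) : PMF (S × A × S) :=
  μ.bind fun x => (M.P x.1 x.2).map fun s' => (x.1, x.2, s')

/-- The sample `(s, a, r, s')` that belongs to `(s, a, s')`. -/
def withReward (M : MDP S A) (x : S × A × S) : S × A × ℝ × S :=
  (x.1, x.2.1, M.R x.1 x.2.1, x.2.2)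

theorem sampleLaw_eq_map (M : MDP S A) (μ : PMF (S × A)) :
    M.sampleLaw μ = (M.tripleLaw μ).map M.withReward := by
  simp [sampleLaw, tripleLaw, PMF.map_bind, PMF.map_comp, Function.comp_def, withReward]

theorem tripleLaw_apply (M : MDP S A) (μ : PMF (S × A)) (x : S × A × S) :
    M.tripleLaw μ x = μ (x.1, x.2.1) * M.P x.1 x.2.1 x.2.2 := by
  classical
  obtain ⟨s, a, t⟩ := x
  rw [tripleLaw, PMF.bind_apply, tsum_eq_single (s, a)]
  · rw [PMF.map_apply, tsum_eq_single t]
    · simp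
    · intro t' ht'
      simp [Ne.symm ht']
  · rintro ⟨s', a'⟩ h
    rw [PMF.map_apply]
    simp only [Prod.mk.injEq, ne_eq, not_and] at h ⊢
    rw [ENNReal.tsum_eq_zero.2, mul_zero]
    intro t'
    rw [if_neg]
    rintro ⟨rfl, rfl, -⟩
    exact h rfl rfl

variable [Fintype S] [Fintype A] [MeasurableSpace S] [MeasurableSingletonClass S]
  [MeasurableSpace A] [MeasurableSingletonClass A]

/-- Expectations over a dataset are finite sums, as the rewards are functions of the other
components. -/
theorem integral_dataLaw (M : MDP S A) (μ : PMF (S × A)) (n : ℕ)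
    {f : (Fin n → S × A × ℝ × S) → ℝ} (hf : StronglyMeasurable f) :
    ∫ D, f D ∂(M.dataLaw μ n) =
      ∑ D : Fin n → S × A × S, (∏ i, (M.tripleLaw μ (D i)).toReal) *
        f fun i => M.withReward (D i) := by
  have hm : Measurable M.withReward := measurable_of_finite _
  have h1 : M.dataLaw μ n = (Measure.pi fun _ : Fin n => (M.tripleLaw μ).toMeasure).map
      fun D i => M.withReward (D i) := by
    rw [dataLaw, Measure.pi_map_pi fun _ => hm.aemeasurable, sampleLaw_eq_map]
    simp only [PMF.toMeasure_map _ _ hm]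
  have hm' : Measurable fun (D : Fin n → S × A × S) (i : Fin n) => M.withReward (D i) :=
    measurable_pi_lambda _ fun i => hm.comp (measurable_pi_apply i)
  rw [h1, integral_map hm'.aemeasurable hf.aestronglyMeasurable,
    integral_fintype (.of_finite)]
  refine Finset.sum_congr rfl fun D _ => ?_
  rw [Measure.real, Measure.pi_singleton, ENNReal.toReal_prod, smul_eq_mul]
  congr 1
  refine Finset.prod_congr rfl fun i _ => ?_
  rw [PMF.toMeasure_apply_singleton _ _ (measurableSet_singleton _)]

end MDP

namespace HardParams

noncomputable section

variable (P : HardParams) (z : unitInterval) (b : P.Plant)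
  {σ : Type*} [Fintype σ] (e : σ ≃ P.St)

theorem tripleLaw_toReal (x : σ × Fin 2 × σ) :
    ((P.mdp z b e).tripleLaw (P.data e) x).toReal =
      (P.data e (x.1, x.2.1)).toReal * P.trans z b (e x.1) x.2.1 (e x.2.2) := by
  rw [MDP.tripleLaw_apply, ENNReal.toReal_mul, mdp_P_toReal]

/-- A dataset is good if `hidden` is not sampled and the samples touch disjoint sets of groups. -/
def Good {n : ℕ} (D : Fin n → σ × Fin 2 × σ) : Prop :=
  (∀ k, ¬ e (D k).1 = .hidden) ∧
    ∀ i j, i ≠ j → Disjoint (P.touched e (D i)) (P.touched e (D j))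

instance {n : ℕ} (D : Fin n → σ × Fin 2 × σ) : Decidable (P.Good e D) :=
  inferInstanceAs (Decidable (_ ∧ _))

/-- On good datasets, averaging over the planted states makes the samples independent, with a law
that does not depend on the reward of `hidden`. -/
theorem expect_tripleLaw_prod {n : ℕ} {D : Fin n → σ × Fin 2 × σ} (hD : P.Good e D) :
    Finset.expect univ (fun b => ∏ i, ((P.mdp z b e).tripleLaw (P.data e) (D i)).toReal) =
      ∏ i, P.refWeight e (D i) := by
  simp only [tripleLaw_toReal, Finset.prod_mul_distrib, refWeight]
  rw [← Finset.mul_expect, expect_prod_of_dependsOn univ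
    (T := fun i => (P.touched e (D i) : Set (Fin P.K × Fin P.M)))
    (fun i _ => P.trans_dependsOn z _ _ _)
    (fun i _ j _ hij => Finset.disjoint_coe.2 (hD.2 i j hij))]
  simp only [expect_trans]

theorem withReward_eq {b b' : P.Plant} {z z' : unitInterval} {x : σ × Fin 2 × σ}
    (hx : ¬ e x.1 = .hidden) :
    (P.mdp z b e).withReward x = (P.mdp z' b' e).withReward x := by
  have : P.reward z (e x.1) = P.reward z' (e x.1) := by
    revert hx
    generalize e x.1 = s
    cases s <;> simp [reward]
  simp [MDP.withReward, mdp, this]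

theorem le_sum_good (n : ℕ) :
    1 - (n * ((1 / 2) ^ P.K / 32) + n ^ 2 * (4 / P.M)) ≤
      ∑ D : Fin n → σ × Fin 2 × σ, (∏ i, P.refWeight e (D i)) *
        (if P.Good e D then 1 else 0) := by
  refine le_trans ?_ (sum_prod_weights_bad_le (P.refWeight_nonneg e) (P.sum_refWeight e)
    (P.touched e) fun x => e x.1 = .hidden)
  have h1 := mul_le_mul_of_nonneg_left (P.sum_refWeight_hidden_le e) (Nat.cast_nonneg (α := ℝ) n)
  have h2 := mul_le_mul_of_nonneg_left (P.sum_sq_refWeight_group_le e)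
    (sq_nonneg (n : ℝ))
  linarith

variable [MeasurableSpace σ] [MeasurableSingletonClass σ]

/-- Two-point lower bound: a test `h` that is evaluated on the dataset cannot be small for all
instances with reward zero in `hidden`, and close to one for all instances with reward one. -/
theorem exists_plant_of_test (n : ℕ) (hn : n * ((1 / 2 : ℝ) ^ P.K / 32) + n ^ 2 * (4 / P.M) ≤ 1 / 2)
    {h : (Fin n → σ × Fin 2 × ℝ × σ) → ℝ} (hm : StronglyMeasurable h) (h0 : ∀ D, 0 ≤ h D)
    (h1 : ∀ D, h D ≤ 1) :
    ∃ b : P.Plant, 1 / 4 ≤ ∫ D, h D ∂((P.mdp 0 b e).dataLaw (P.data e) n) ∨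
      1 / 4 ≤ ∫ D, (1 - h D) ∂((P.mdp 1 b e).dataLaw (P.data e) n) := by
  by_contra! hcon
  -- the reward functions do not depend on the planted states
  let b₀ : P.Plant := Classical.arbitrary _
  have avg : ∀ (z : unitInterval) (f : (Fin n → σ × Fin 2 × ℝ × σ) → ℝ), StronglyMeasurable f →
      (∀ D, 0 ≤ f D) →
      (∀ b, ∫ D, f D ∂((P.mdp z b e).dataLaw (P.data e) n) < 1 / 4) →
      ∑ D : Fin n → σ × Fin 2 × σ, (∏ i, P.refWeight e (D i)) * (if P.Good e D then
        f fun i => (P.mdp 0 b₀ e).withReward (D i) else 0) < 1 / 4 := by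
    intro z f hf hf0 hlt
    have e1 : Finset.expect univ
        (fun b => ∫ D, f D ∂((P.mdp z b e).dataLaw (P.data e) n)) < 1 / 4 := by
      rw [← Finset.expect_const (univ_nonempty (α := P.Plant)) (1 / 4 : ℝ)]
      exact Finset.expect_lt_expect (fun b _ => (hlt b).le) ⟨b₀, mem_univ _, hlt b₀⟩
    refine lt_of_le_of_lt ?_ e1
    calc _ = ∑ D : Fin n → σ × Fin 2 × σ, Finset.expect univ (fun b =>
          (∏ i, ((P.mdp z b e).tripleLaw (P.data e) (D i)).toReal) * (if P.Good e D then
          f fun i => (P.mdp 0 b₀ e).withReward (D i) else 0)) := by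
          refine Finset.sum_congr rfl fun D _ => ?_
          by_cases hD : P.Good e D
          · rw [← Finset.expect_mul, P.expect_tripleLaw_prod z e hD]
          · simp [hD]
      _ = Finset.expect univ (fun b => ∑ D : Fin n → σ × Fin 2 × σ,
          (∏ i, ((P.mdp z b e).tripleLaw (P.data e) (D i)).toReal) * (if P.Good e D then
          f fun i => (P.mdp 0 b₀ e).withReward (D i) else 0)) :=
          (Finset.expect_sum_comm _ _ _).symm
      _ ≤ _ := by
          refine Finset.expect_le_expect fun b _ => ?_
          rw [MDP.integral_dataLaw _ _ _ hf]
          refine Finset.sum_le_sum fun D _ => mul_le_mul_of_nonneg_left ?_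
            (Finset.prod_nonneg fun _ _ => ENNReal.toReal_nonneg)
          split_ifs with hD
          · refine le_of_eq (congrArg f (funext fun i => ?_))
            exact P.withReward_eq e (hD.1 i)
          · exact hf0 _
  have e0 := avg 0 h hm h0 fun b => (hcon b).1
  have e1 := avg 1 (fun D => 1 - h D) (stronglyMeasurable_const.sub hm)
    (fun D => sub_nonneg.2 (h1 D)) fun b => (hcon b).2
  have e2 := P.le_sum_good e n
  have e3 := add_lt_add e0 e1
  rw [← Finset.sum_add_distrib] at e3
  have e4 : ∀ D : Fin n → σ × Fin 2 × σ, (∏ i, P.refWeight e (D i)) * (if P.Good e D then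
        h fun i => (P.mdp 0 b₀ e).withReward (D i) else 0) +
      (∏ i, P.refWeight e (D i)) * (if P.Good e D then
        1 - h fun i => (P.mdp 0 b₀ e).withReward (D i) else 0) =
      (∏ i, P.refWeight e (D i)) * (if P.Good e D then 1 else 0) := fun D => by
    rw [← mul_add]; split_ifs <;> simp
  simp only [e4] at e3
  linarith

theorem measurable_policy_eval {σ : Type*} (s : σ) (a : Fin 2) :
    Measurable fun π : Policy σ (Fin 2) => (π s a).toReal := by
  have h1 : Measurable fun p : PMF (Fin 2) => p a :=
    (measurable_pi_apply a).comp (comap_measurable fun (p : PMF (Fin 2)) (a : Fin 2) => p a)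
  exact (h1.comp (measurable_pi_apply s)).ennreal_toReal

/-- Every algorithm has constant regret on some instance. -/
theorem exists_regret (n : ℕ) (hn : n * ((1 / 2 : ℝ) ^ P.K / 32) + n ^ 2 * (4 / P.M) ≤ 1 / 2)
    (alg : Kernel (Fin n → σ × Fin 2 × ℝ × σ) (Policy σ (Fin 2))) [IsMarkovKernel alg] :
    ∃ (z : unitInterval) (b : P.Plant), (z = 0 ∨ z = 1) ∧ ∃ f : σ → Fin 2,
      (P.mdp z b e).IsOptimal f ∧
      P.gap / 4 ≤ (P.mdp z b e).J (MDP.detPolicy f) -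
        ∫ D, (∫ π, (P.mdp z b e).J π ∂(alg D)) ∂((P.mdp z b e).dataLaw (P.data e) n) := by
  let risky : Policy σ (Fin 2) → ℝ := fun π => (π (e.symm .decide) 0).toReal
  have hr : Measurable risky := measurable_policy_eval _ _
  have hr0 : ∀ π, 0 ≤ risky π := fun π => ENNReal.toReal_nonneg
  have hr1 : ∀ π, risky π ≤ 1 := fun π => policy_le_one _ _
  have hri : ∀ D, Integrable risky (alg D) := fun D =>
    .of_bound hr.aestronglyMeasurable 1 (.of_forall fun π => by
      rw [Real.norm_of_nonneg (hr0 π)]; exact hr1 π)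
  let h : (Fin n → σ × Fin 2 × ℝ × σ) → ℝ := fun D => ∫ π, risky π ∂(alg D)
  have hm : StronglyMeasurable h :=
    StronglyMeasurable.integral_kernel (f := risky) hr.stronglyMeasurable
  have h0 : ∀ D, 0 ≤ h D := fun D => integral_nonneg hr0
  have h1 : ∀ D, h D ≤ 1 := fun D => by
    calc h D ≤ ∫ _, (1 : ℝ) ∂(alg D) := integral_mono (hri D) (integrable_const _) hr1
      _ = 1 := by simp
  have hprob : ∀ z b, IsProbabilityMeasure ((P.mdp z b e).dataLaw (P.data e) n) := fun z b => by
    unfold MDP.dataLaw; infer_instance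
  have hhi : ∀ z b, Integrable h ((P.mdp z b e).dataLaw (P.data e) n) := fun z b =>
    .of_bound hm.aestronglyMeasurable 1 (.of_forall fun D => by
      rw [Real.norm_of_nonneg (h0 D)]; exact h1 D)
  have hJ : ∀ (z : unitInterval) (b : P.Plant) (c₁ c₂ : ℝ),
      (∀ π, (P.mdp z b e).J π = c₁ + c₂ * risky π) →
      ∫ D, (∫ π, (P.mdp z b e).J π ∂(alg D)) ∂((P.mdp z b e).dataLaw (P.data e) n) =
        c₁ + c₂ * ∫ D, h D ∂((P.mdp z b e).dataLaw (P.data e) n) := by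
    intro z b c₁ c₂ hc
    have e1 : ∀ D, ∫ π, (P.mdp z b e).J π ∂(alg D) = c₁ + c₂ * h D := fun D => by
      simp only [hc]
      rw [integral_add (integrable_const _) ((hri D).const_mul _), integral_const_mul]
      simp [h]
    simp only [e1]
    rw [integral_add (integrable_const _) ((hhi z b).const_mul _), integral_const_mul]
    simp
  obtain ⟨b, hb | hb⟩ := P.exists_plant_of_test e n hn hm h0 h1
  · refine ⟨0, b, Or.inl rfl, fun _ => 1, P.mdp_zero_isOptimal b e, ?_⟩
    rw [hJ 0 b ((P.mdp 0 b e).J (MDP.detPolicy fun _ => 1)) (-P.gap) fun π => by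
      have := P.mdp_zero_regret b e π
      simp only [risky]; linarith]
    nlinarith [P.gap_nonneg]
  · refine ⟨1, b, Or.inr rfl, fun _ => 0, P.mdp_one_isOptimal b e, ?_⟩
    rw [hJ 1 b ((P.mdp 1 b e).J (MDP.detPolicy fun _ => 0) - P.gap) P.gap fun π => by
      have := P.mdp_one_regret b e π
      simp only [risky]; linarith]
    rw [integral_sub (integrable_const _) (hhi 1 b)] at hb
    simp at hb
    nlinarith [P.gap_nonneg]

end

end HardParams

/-! ### Choice of the parameters -/

theorem exp_neg_two_mul_le {x : ℝ} (h0 : 0 ≤ x) (h1 : x ≤ 1 / 2) : Real.exp (-(2 * x)) ≤ 1 - x := by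
  rw [Real.exp_neg, inv_le_comm₀ (Real.exp_pos _) (by linarith)]
  have h2 := Real.add_one_le_exp (2 * x)
  refine le_trans ?_ h2
  rw [inv_le_iff_one_le_mul₀ (by linarith)]
  nlinarith

/-- The regret is of constant order, as neither discounting nor the loss of mass in the layers adds
up to more than a constant factor over `K ≤ 1 / (1 - γ)` layers. -/
theorem HardParams.exp_le_gap (P : HardParams) (hγ : 1 / 2 ≤ P.γ) (hK : P.K * (1 - P.γ) ≤ 1) :
    Real.exp (-6) / 16 ≤ P.gap := by
  have h1 : Real.exp (-2) ≤ P.γ ^ P.K := by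
    calc Real.exp (-2) ≤ Real.exp (-(2 * (1 - P.γ))) ^ P.K := by
          rw [← Real.exp_nat_mul]
          exact Real.exp_le_exp.2 (by linarith)
      _ ≤ (1 - (1 - P.γ)) ^ P.K := pow_le_pow_left₀ (Real.exp_pos _).le
          (exp_neg_two_mul_le (by linarith [P.γ_mem.2]) (by linarith)) _
      _ = _ := by rw [sub_sub_cancel]
  have h2 : Real.exp (-4) ≤ P.surv ^ P.K := by
    calc Real.exp (-4) = Real.exp (-(2 * P.θ)) ^ (2 * P.K) := by
          rw [← Real.exp_nat_mul]
          have := P.θ_mul_K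
          push_cast
          congr 1
          linear_combination 4 * this
      _ ≤ (1 - P.θ) ^ (2 * P.K) := pow_le_pow_left₀ (Real.exp_pos _).le
          (exp_neg_two_mul_le P.θ_pos.le P.θ_le) _
      _ = _ := by rw [HardParams.surv, pow_mul]
  have h3 : Real.exp (-6) ≤ (P.γ * P.surv) ^ P.K := by
    rw [mul_pow, show (-6 : ℝ) = -2 + -4 by norm_num, Real.exp_add]
    exact mul_le_mul h1 h2 (Real.exp_pos _).le (pow_nonneg P.γ_mem.1 _)
  have h4 := Real.exp_pos (-6)
  unfold HardParams.gap
  nlinarith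

theorem sq_add_five_le {S : ℕ} (hS : 9 ≤ S) : (Nat.log 2 S - 1) ^ 2 + 5 ≤ S := by
  have h1 : 2 ^ Nat.log 2 S ≤ S := Nat.pow_log_le_self 2 (by omega)
  have h2 : ∀ k, (k + 3) ^ 2 + 5 ≤ 2 ^ (k + 4) := fun k => by
    induction k with
    | zero => norm_num
    | succ k ih => rw [pow_succ 2 (k + 4)]; nlinarith
  by_cases h : Nat.log 2 S ≤ 3
  · have : (Nat.log 2 S - 1) ^ 2 ≤ 2 ^ 2 := Nat.pow_le_pow_left (by omega) 2
    omega
  · obtain ⟨k, hk⟩ : ∃ k, Nat.log 2 S = k + 4 := ⟨Nat.log 2 S - 4, by omega⟩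
    rw [hk] at h1 ⊢
    exact (h2 k).trans h1

theorem one_le_log {S : ℕ} (hS : 9 ≤ S) : 1 ≤ Real.log S := by
  rw [Real.le_log_iff_exp_le (by positivity)]
  have h1 : (9 : ℝ) ≤ S := by exact_mod_cast hS
  linarith [Real.exp_one_lt_d9]

/-- The third term of the minimum, in the form in which it controls collisions. -/
theorem cbrt_div_log_sq_le {S : ℕ} (hS : 9 ≤ S) :
    ((S : ℝ) ^ (1 / 3 : ℝ) / Real.log S ^ 2 * Real.log S) ^ 2 ≤ S := by
  have hl := one_le_log hS
  have h1 : (1 : ℝ) ≤ S := by exact_mod_cast (by omega : 1 ≤ S)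
  have hy0 : 0 ≤ (S : ℝ) ^ (1 / 3 : ℝ) := by positivity
  have e : (S : ℝ) ^ (1 / 3 : ℝ) / Real.log S ^ 2 * Real.log S =
      (S : ℝ) ^ (1 / 3 : ℝ) / Real.log S := by field_simp
  rw [e]
  calc ((S : ℝ) ^ (1 / 3 : ℝ) / Real.log S) ^ 2 ≤ ((S : ℝ) ^ (1 / 3 : ℝ)) ^ 2 :=
        pow_le_pow_left₀ (by positivity) (div_le_self hy0 hl) 2
    _ = (S : ℝ) ^ (2 / 3 : ℝ) := by
        rw [← Real.rpow_natCast, ← Real.rpow_mul (by positivity)]; norm_num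
    _ ≤ (S : ℝ) ^ (1 : ℝ) := Real.rpow_le_rpow_of_exponent_le h1 (by norm_num)
    _ = S := Real.rpow_one _

theorem cbrt_div_log_sq_le_two_pow {S : ℕ} (hS : 9 ≤ S) :
    (S : ℝ) ^ (1 / 3 : ℝ) / Real.log S ^ 2 ≤ 4 * 2 ^ (Nat.log 2 S - 1) := by
  have hl := one_le_log hS
  have h1 : (1 : ℝ) ≤ S := by exact_mod_cast (by omega : 1 ≤ S)
  have h2 : S < 2 ^ (Nat.log 2 S + 1) := Nat.lt_pow_succ_log_self (by norm_num) S
  have h3 : 3 ≤ Nat.log 2 S := Nat.le_log_of_pow_le (by norm_num) (by omega)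
  calc (S : ℝ) ^ (1 / 3 : ℝ) / Real.log S ^ 2 ≤ (S : ℝ) ^ (1 / 3 : ℝ) :=
        div_le_self (by positivity) (one_le_pow₀ hl)
    _ ≤ (S : ℝ) ^ (1 : ℝ) := Real.rpow_le_rpow_of_exponent_le h1 (by norm_num)
    _ = S := Real.rpow_one _
    _ ≤ 2 ^ (Nat.log 2 S + 1) := by exact_mod_cast h2.le
    _ = 4 * 2 ^ (Nat.log 2 S - 1) := by
        rw [show Nat.log 2 S + 1 = (Nat.log 2 S - 1) + 2 by omega, pow_add]; ring

theorem two_rpow_le (x : ℝ) : (2 : ℝ) ^ x ≤ 4 * 2 ^ ⌊x⌋₊ := by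
  calc (2 : ℝ) ^ x ≤ (2 : ℝ) ^ ((⌊x⌋₊ + 1 : ℕ) : ℝ) :=
        Real.rpow_le_rpow_of_exponent_le one_le_two (by exact_mod_cast (Nat.lt_floor_add_one x).le)
    _ = 2 * 2 ^ ⌊x⌋₊ := by rw [Real.rpow_natCast, pow_succ]; ring
    _ ≤ _ := by gcongr; norm_num

/-- For the sample sizes in question, bad datasets have probability at most one half. -/
theorem sample_size_bound {S K M n : ℕ} {C γ : ℝ} (hS : 9 ≤ S)
    (hK : K = min ⌊C / 32⌋₊ (min ⌊1 / (1 - γ)⌋₊ (Nat.log 2 S - 1))) (hM0 : 0 < M)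
    (hM : S - 5 < K ^ 2 * (M + 1))
    (hn : (n : ℝ) < 1 / 20 * min ((S : ℝ) ^ (1 / 3 : ℝ) / Real.log (S : ℝ) ^ 2)
              (min ((2 : ℝ) ^ (C / 32)) ((2 : ℝ) ^ (1 / (1 - γ))))) :
    n * ((1 / 2 : ℝ) ^ K / 32) + n ^ 2 * (4 / M) ≤ 1 / 2 := by
  set x := (S : ℝ) ^ (1 / 3 : ℝ) / Real.log (S : ℝ) ^ 2 with hx
  have hl := one_le_log hS
  have hSpos : (0 : ℝ) < S := by exact_mod_cast (by omega : 0 < S)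
  have hMpos : (0 : ℝ) < M := by exact_mod_cast hM0
  have h1 : (n : ℝ) ≤ 2 ^ K := by
    -- whichever term attains the minimum in `K` gives the bound
    have h2 : min x (min ((2 : ℝ) ^ (C / 32)) ((2 : ℝ) ^ (1 / (1 - γ)))) ≤ 4 * 2 ^ K := by
      rcases min_choice ⌊C / 32⌋₊ (min ⌊1 / (1 - γ)⌋₊ (Nat.log 2 S - 1)) with h | h
      · rw [hK, h]
        exact ((min_le_right _ _).trans (min_le_left _ _)).trans (two_rpow_le _)
      · rcases min_choice ⌊1 / (1 - γ)⌋₊ (Nat.log 2 S - 1) with h' | h'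
        · rw [hK, h, h']
          exact ((min_le_right _ _).trans (min_le_right _ _)).trans (two_rpow_le _)
        · rw [hK, h, h']
          exact (min_le_left _ _).trans (cbrt_div_log_sq_le_two_pow hS)
    have : (0 : ℝ) < 2 ^ K := by positivity
    linarith
  have h2 : (n : ℝ) * ((1 / 2 : ℝ) ^ K / 32) ≤ 1 / 32 := by
    have h3 := mul_le_mul_of_nonneg_right h1 (by positivity : (0 : ℝ) ≤ (1 / 2 : ℝ) ^ K)
    rw [← mul_pow, show (2 : ℝ) * (1 / 2) = 1 by norm_num, one_pow] at h3
    linarith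
  have h3 : (n : ℝ) ≤ 1 / 20 * x := hn.le.trans
    (mul_le_mul_of_nonneg_left (min_le_left _ _) (by norm_num))
  have h4 : (K : ℝ) ≤ 2 * Real.log S := by
    have h5 : K ≤ Nat.log 2 S := by omega
    have h6 : (2 : ℝ) ^ K ≤ S := by
      exact_mod_cast (Nat.pow_le_pow_right two_pos h5).trans (Nat.pow_log_le_self 2 (by omega))
    have h7 := Real.log_le_log (by positivity) h6
    rw [Real.log_pow] at h7
    have h8 := Real.log_two_gt_d9
    nlinarith [Nat.cast_nonneg (α := ℝ) K]
  have h5 : ((n : ℝ) * K) ^ 2 ≤ S / 100 := by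
    have h6 : (n : ℝ) * K ≤ 1 / 10 * (x * Real.log S) := by
      have := mul_le_mul h3 h4 (Nat.cast_nonneg K) ((Nat.cast_nonneg n).trans h3)
      linarith
    have h7 := pow_le_pow_left₀ (by positivity) h6 2
    rw [mul_pow (1 / 10 : ℝ)] at h7
    linarith [cbrt_div_log_sq_le hS]
  have h6 : (4 : ℝ) * S ≤ 18 * (K ^ 2 * M) := by
    have h7 : K ^ 2 * (M + 1) ≤ K ^ 2 * (2 * M) := Nat.mul_le_mul_left _ (by omega)
    have h8 : 4 * S ≤ 9 * (K ^ 2 * (2 * M)) := by omega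
    have h9 : ((4 * S : ℕ) : ℝ) ≤ ((9 * (K ^ 2 * (2 * M)) : ℕ) : ℝ) := by exact_mod_cast h8
    push_cast at h9
    linarith
  have hKpos : (0 : ℝ) < (K : ℝ) ^ 2 := by
    rcases (sq_nonneg (K : ℝ)).eq_or_lt with h | h
    · rw [← h, zero_mul, mul_zero] at h6; linarith
    · exact h
  have h7 : (n : ℝ) ^ 2 * (4 / M) ≤ 1 / 4 := by
    rw [mul_div_assoc', div_le_iff₀ hMpos]
    rw [mul_pow] at h5
    refine le_of_mul_le_mul_left ?_ hKpos
    linarith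
  linarith

theorem theorem2 :
    ∃ c c' : ℝ, 0 < c ∧ 0 < c' ∧
      ∀ (S : ℕ) (γ C : ℝ), 9 ≤ S → 1 / 2 < γ → γ < 1 → 64 ≤ C →
        ∃ (d₀ : PMF (Fin S)) (𝓜 : Set (MDP (Fin S) (Fin 2)))
          (𝓕 : Finset (Fin S → Fin 2 → ℝ)) (μ : PMF (Fin S × Fin 2)),
          𝓕.card = 2 ∧
          (∀ M ∈ 𝓜, M.γ = γ ∧ M.d₀ = d₀ ∧ M.IsAdmissibleMixture μ ∧
            (∀ π : Policy (Fin S) (Fin 2), M.Q π ∈ 𝓕) ∧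
            M.concCoeff μ ≤ ENNReal.ofReal C) ∧
          ∀ n : ℕ,
            (n : ℝ) < c * min ((S : ℝ) ^ (1 / 3 : ℝ) / Real.log (S : ℝ) ^ 2)
              (min ((2 : ℝ) ^ (C / 32)) ((2 : ℝ) ^ (1 / (1 - γ)))) →
            ∀ (alg : Kernel (Fin n → Fin S × Fin 2 × ℝ × Fin S) (Policy (Fin S) (Fin 2)))
              [IsMarkovKernel alg],
              ∃ M ∈ 𝓜, ∃ f : Fin S → Fin 2, M.IsOptimal f ∧
                c' ≤ M.J (MDP.detPolicy f) - ∫ D, (∫ π, M.J π ∂(alg D)) ∂(M.dataLaw μ n) := by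
  classical
  refine ⟨1 / 20, Real.exp (-6) / 64, by norm_num, by positivity, ?_⟩
  intro S γ C hS hγ hγ1 hC
  obtain ⟨K, hK⟩ : ∃ K, K = min ⌊C / 32⌋₊ (min ⌊1 / (1 - γ)⌋₊ (Nat.log 2 S - 1)) := ⟨_, rfl⟩
  have hK2 : 2 ≤ K := by
    have h1 : 2 ≤ ⌊C / 32⌋₊ := Nat.le_floor (by push_cast; linarith)
    have h2 : 2 ≤ ⌊1 / (1 - γ)⌋₊ := Nat.le_floor (by
      push_cast
      rw [le_div_iff₀ (by linarith)]
      linarith)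
    have h3 : 3 ≤ Nat.log 2 S := Nat.le_log_of_pow_le (by norm_num) (by omega)
    omega
  have hKC : 32 * (K : ℝ) ≤ C := by
    have h1 : (K : ℝ) ≤ ⌊C / 32⌋₊ := by exact_mod_cast hK ▸ min_le_left _ _
    have h2 := Nat.floor_le (by linarith : 0 ≤ C / 32)
    linarith
  have hKγ : K * (1 - γ) ≤ 1 := by
    have h1 : (K : ℝ) ≤ ⌊1 / (1 - γ)⌋₊ := by
      exact_mod_cast hK ▸ (min_le_right _ _).trans (min_le_left _ _)
    have h2 := Nat.floor_le (one_div_nonneg.2 (by linarith : 0 ≤ 1 - γ))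
    exact (le_div_iff₀ (by linarith)).1 (h1.trans h2)
  have hKS : K ^ 2 + 5 ≤ S := by
    have h1 : K ≤ Nat.log 2 S - 1 := by omega
    exact (Nat.add_le_add_right (Nat.pow_le_pow_left h1 2) 5).trans (sq_add_five_le hS)
  have hK0 : 0 < K ^ 2 := by positivity
  have hM0 : 0 < (S - 5) / K ^ 2 := Nat.div_pos (by omega) hK0
  have hM1 : S - 5 < K ^ 2 * ((S - 5) / K ^ 2 + 1) := Nat.lt_mul_div_succ _ hK0
  let P : HardParams :=
    { K := K, M := (S - 5) / K ^ 2, r := S - 5 - K * ((S - 5) / K ^ 2 * K), γ := γ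
      two_le_K := hK2, M_pos := hM0, γ_mem := ⟨by linarith, hγ1⟩ }
  have hcard : Fintype.card P.St = S := by
    rw [HState.card_eq]
    have h1 : K ^ 2 * ((S - 5) / K ^ 2) ≤ S - 5 := Nat.mul_div_le _ _
    have h2 : K * ((S - 5) / K ^ 2 * K) = K ^ 2 * ((S - 5) / K ^ 2) := by ring
    change 5 + K * ((S - 5) / K ^ 2 * K) + (S - 5 - K * ((S - 5) / K ^ 2 * K)) = S
    omega
  let e : Fin S ≃ P.St := (Fintype.equivFinOfCardEq hcard).symm
  refine ⟨P.initPMF e, {M | ∃ (z : unitInterval) (b : P.Plant), (z = 0 ∨ z = 1) ∧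
    M = P.mdp z b e}, {fun s a => P.qFun 0 (e s) a, fun s a => P.qFun 1 (e s) a}, P.data e,
    ?_, ?_, ?_⟩
  · refine Finset.card_pair fun h => ?_
    have := congrFun (congrFun h (e.symm .hidden)) 0
    simp [HardParams.qFun, HardParams.val] at this
  · rintro M ⟨z, b, hz, rfl⟩
    refine ⟨rfl, rfl, P.isAdmissibleMixture_data z b e, fun π => ?_,
      P.concCoeff_data_le z b e hKC⟩
    rw [P.mdp_Q]
    rcases hz with rfl | rfl <;> simp
  · intro n hn alg _
    obtain ⟨z, b, hz, f, hf, hreg⟩ :=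
      P.exists_regret e n (sample_size_bound hS hK hM0 hM1 hn) alg
    refine ⟨P.mdp z b e, ⟨z, b, hz, rfl⟩, f, hf, le_trans ?_ hreg⟩
    linarith [P.exp_le_gap hγ.le hKγ]
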